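/- **Setting.** Let $X_{k+1}=f(X_k,U_k,\xi_k)$, $X_0\sim p_0$, $Y_k=h(X_k,\eta_k)$ ($k\ge 0$) with values in $\mathbb R^{n_x}$ and $\mathbb R^{n_y}$, where $f,h$ are measurable, $(\xi_k)$ and $(\eta_k)$ are i.i.d. sequences with laws $p_\xi$ and $p_\eta$, and $X_0,(\xi_k),(\eta_k)$ are independent. Put $I_k=(Y_0,U_0,\dots,Y_{k-1},U_{k-1},Y_k)$ and let $U_k=\pi_k(I_k)$ with measurable $\pi_k$ valued in a set $\mathcal U\subset\mathbb R^{n_u}$. For all $x\in\mathbb R^{n_x}$, $u\in\mathbb R^{n_u}$, the law of $f(x,u,\xi_k)$ has the Lebesgue density $K(\cdot,x,u)$ and the law of $h(x,\eta_k)$ has the Lebesgue density $\rho(\cdot,x)$, where $K,\rho$ are measurable with values in $[0,\infty)$ (in particular finite everywhere). Let $\mu_k$ and $\mu_{k|k-1}$ be the conditional laws of $X_k$ given $I_k$ and given $I_{k-1}$, let $\hat X_k^*=E[X_k\mid I_k]$, $\phi_j(x)=x_j$, $\langle\mu,\psi\rangle=\int\psi\,d\mu$, and $$\|\phi_j\|_{k,2}=\max\bigl(1,\langle\mu_0,\phi_j^2\rangle^{1/2},\dots,\langle\mu_k,\phi_j^2\rangle^{1/2}\bigr).$$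 **Particle filter.** Let $\gamma_k>0$ and $0<\varepsilon_k<1$ ($k\ge1$) be constants. For each $N$, given $I_0$, the particles $x_0^1,\dots,x_0^N$ are i.i.d. with law $\mu_0$. At each time $k\ge1$, given the particles $x_{k-1}^1,\dots,x_{k-1}^N$ at time $k-1$: (i) draw independent $\bar x^i\sim\sum_j a_{ij}K(z,x_{k-1}^j,U_{k-1})\,dz$, $i=1,\dots,N$, where $a=(a_{ij})$ is a fixed doubly stochastic matrix that may depend on $N$ and $k$ (for $a$ the identity, each particle moves by $K$); (ii) repeat (i) until $\frac1N\sum_i\rho(Y_k,\bar x^i)\ge\gamma_k/2$ (so the accepted particles have the law of (i) conditioned on this event; if it has probability $0$, all particles are put at the origin, by convention); (iii) draw $x_k^1,\dots,x_k^N$ independently from $\sum_i w_i\delta_{\bar x^i}$ with $w_i\propto\rho(Y_k,\bar x^i)$. Let $\mu^N_{k|k-1}$ be the empirical measure of the first proposals $\bar x^i$ in (i), before selection, and $\hat X_k^N=\frac1N\sum_i x_k^i$. The total mean square errors are $$e^{tot}_{k,*}=E\|X_k-\hat X_k^*\|^2,\qquad e^{tot}_{k,N}=E\|X_k-\hat X_k^N\|^2,$$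 the latter expectation being taken also over the particles, which, given $I_k$, are conditionally independent of $X_k$. **Assumptions.** 1. For every $k\ge1$ and almost all $i_k$: $\langle\mu_{k|k-1},\rho(y_k,\cdot)\rangle\ge\gamma_k$, and there is $N_k(i_k)$ such that $P(\langle\mu^N_{k|k-1},\rho(y_k,\cdot)\rangle>\gamma_k\mid I_k=i_k)\ge1-\varepsilon_k$ for all $N\ge N_k(i_k)$. 2. $E\|X_k\|^2<\infty$ for all $k\ge0$. 3. $\sup_{z,x\in\mathbb R^{n_x},\,u\in\mathcal U}K(z,x,u)\le B_K$, $\sup_{x,y}\rho(y,x)\le B_\rho$ and $\sup_{x,y}\phi_j(x)^2\rho(y,x)\le B_j$ for $j=1,\dots,n_x$, with finite constants $B_K,B_\rho,B_1,\dots,B_{n_x}$. **Theorem.** There are constants $C'_{k,j}\in(0,\infty)$ ($k\ge0$, $1\le j\le n_x$), depending only on the dimensions, on the sequences $(\gamma_l)_l,(\varepsilon_l)_l$ and on $B_K,B_\rho,(B_j)_j$, and, for every $0<q<1$, thresholds $\bar N_k>0$ depending only on these data and on $q$ (thus not on $i_k$), such that for every system and particle filter as above that satisfy Assumptions 1–3,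 for every $k\ge0$ and every $N\ge\bar N_k$, $$e^{tot}_{k,*}\le e^{tot}_{k,N}\le\Bigl(1+\frac1{N^q}\Bigr)e^{tot}_{k,*}+(1+N^q)\,\frac{\sum_{j=1}^{n_x}C'_{k,j}\,E\bigl[\|\phi_j\|_{k,2}^2\bigr]}{N}<\infty .$$ In particular $E\|X_k-\hat X_k^N\|^2\to E\|X_k-\hat X_k^*\|^2$ as $N\to\infty$. -/

import Mathlib

open MeasureTheory ProbabilityTheory Filter Topology
open scoped ENNReal NNReal

/-- Euclidean space `ℝⁿ`. -/
abbrev Vec (n : ℕ) : Type := EuclideanSpace ℝ (Fin n)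

/-! ## The controlled, partially observed system -/

/-- The data of the system `X_{k+1} = f(X_k, U_k, ξ_k)`, `Y_k = h(X_k, η_k)`: initial law, noise laws,
dynamics, observation map, admissible controls, transition density `K(z, x, u)` and likelihood
`ρ(y, x)` (finite nonnegative functions, densities with respect to Lebesgue measure). -/
structure ControlledSystem (nx nu nξ ny nη : ℕ) where
  p₀ : Measure (Vec nx)
  pξ : Measure (Vec nξ)
  pη : Measure (Vec nη)
  prob_p₀ : IsProbabilityMeasure p₀
  prob_pξ : IsProbabilityMeasure pξ
  prob_pη : IsProbabilityMeasure pη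
  f : Vec nx → Vec nu → Vec nξ → Vec nx
  measurable_f : Measurable fun p : Vec nx × Vec nu × Vec nξ => f p.1 p.2.1 p.2.2
  h : Vec nx → Vec nη → Vec ny
  measurable_h : Measurable fun p : Vec nx × Vec nη => h p.1 p.2
  /-- the set of admissible control values -/
  𝒰 : Set (Vec nu)
  K : Vec nx → Vec nx → Vec nu → ℝ≥0
  measurable_K : Measurable fun p : Vec nx × Vec nx × Vec nu => K p.1 p.2.1 p.2.2
  /-- `P(X_{k+1} ∈ A | X_k = x, U_k = u) = ∫_A K(z, x, u) dz` -/
  law_f : ∀ x u, pξ.map (fun e => f x u e) = volume.withDensity fun z => (K z x u : ℝ≥0∞)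
  ρ : Vec ny → Vec nx → ℝ≥0
  measurable_ρ : Measurable fun p : Vec ny × Vec nx => ρ p.1 p.2
  /-- `P(Y_k ∈ B | X_k = x) = ∫_B ρ(y, x) dy` -/
  law_h : ∀ x, pη.map (fun e => h x e) = volume.withDensity fun y => (ρ y x : ℝ≥0∞)

attribute [instance] ControlledSystem.prob_p₀ ControlledSystem.prob_pξ ControlledSystem.prob_pη

/-- Values of the information vector `I_k = (Y_0, U_0, …, Y_{k-1}, U_{k-1}, Y_k)`, stored as
`((Y_0, …, Y_k), (U_0, …, U_{k-1}))`. -/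
abbrev Info (ny nu k : ℕ) : Type := (Fin (k + 1) → Vec ny) × (Fin k → Vec nu)

namespace Info

variable {ny nu k : ℕ}

/-- `i_k` extracted from `i_{k+1}`. -/
def prev (i : Info ny nu (k + 1)) : Info ny nu k :=
  (fun j => i.1 j.castSucc, fun j => i.2 j.castSucc)

/-- `(u_k, y_{k+1})` extracted from `i_{k+1}`. -/
def last (i : Info ny nu (k + 1)) : Vec nu × Vec ny :=
  (i.2 (Fin.last k), i.1 (Fin.last (k + 1)))

lemma measurable_prev : Measurable (prev : Info ny nu (k + 1) → Info ny nu k) := by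
  unfold prev; fun_prop

lemma measurable_last : Measurable (last : Info ny nu (k + 1) → Vec nu × Vec ny) := by
  unfold last; fun_prop

end Info

/-- The information vector `I_k` as a random variable. -/
def infoVec {Ω : Type*} {ny nu : ℕ} (Y : ℕ → Ω → Vec ny) (U : ℕ → Ω → Vec nu) (k : ℕ) (ω : Ω) :
    Info ny nu k :=
  (fun j => Y j ω, fun j => U j ω)

/-- `(X, Y, U)` is the system `M` driven by the initial state `X_0` and the noises `ξ`, `η`
(all independent), in closed loop with the control policy `U_k = π_k(I_k)`. -/
structure IsClosedLoop {Ω : Type*} [MeasurableSpace Ω] {nx nu nξ ny nη : ℕ}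
    (M : ControlledSystem nx nu nξ ny nη) (P : Measure Ω)
    (π : (k : ℕ) → Info ny nu k → Vec nu)
    (X : ℕ → Ω → Vec nx) (Y : ℕ → Ω → Vec ny) (U : ℕ → Ω → Vec nu)
    (ξ : ℕ → Ω → Vec nξ) (η : ℕ → Ω → Vec nη) : Prop where
  measurable_policy : ∀ k, Measurable (π k)
  policy_mem : ∀ k i, π k i ∈ M.𝒰
  measurable_init : Measurable (X 0)
  measurable_ξ : ∀ k, Measurable (ξ k)
  measurable_η : ∀ k, Measurable (η k)
  law_init : P.map (X 0) = M.p₀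
  law_ξ : ∀ k, P.map (ξ k) = M.pξ
  law_η : ∀ k, P.map (η k) = M.pη
  indep_ξ : iIndepFun ξ P
  indep_η : iIndepFun η P
  indep_ξ_η : IndepFun (fun ω k => ξ k ω) (fun ω k => η k ω) P
  indep_init : IndepFun (X 0) (fun ω => ((fun k => ξ k ω), (fun k => η k ω))) P
  dynamics : ∀ k ω, X (k + 1) ω = M.f (X k ω) (U k ω) (ξ k ω)
  observation : ∀ k ω, Y k ω = M.h (X k ω) (η k ω)
  control : ∀ k ω, U k ω = π k (infoVec Y U k ω)

/-! ## Optimal filter and optimal error -/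

section Filter

variable {Ω : Type*} [MeasurableSpace Ω] {nx nu ny : ℕ}

/-- The filtering distribution `μ_k`: the conditional law of `X_k` given `I_k`. -/
noncomputable def filterLaw (P : Measure Ω) [IsFiniteMeasure P] (X : ℕ → Ω → Vec nx)
    (Y : ℕ → Ω → Vec ny) (U : ℕ → Ω → Vec nu) (k : ℕ) : Kernel (Info ny nu k) (Vec nx) :=
  condDistrib (X k) (infoVec Y U k) P

instance (P : Measure Ω) [IsFiniteMeasure P] (X : ℕ → Ω → Vec nx) (Y : ℕ → Ω → Vec ny)
    (U : ℕ → Ω → Vec nu) (k : ℕ) : IsMarkovKernel (filterLaw P X Y U k) :=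
  inferInstanceAs (IsMarkovKernel (condDistrib (X k) (infoVec Y U k) P))

/-- The predicted distribution `μ_{k+1|k}`: the conditional law of `X_{k+1}` given `I_k`. -/
noncomputable def predictedLaw (P : Measure Ω) [IsFiniteMeasure P] (X : ℕ → Ω → Vec nx)
    (Y : ℕ → Ω → Vec ny) (U : ℕ → Ω → Vec nu) (k : ℕ) : Kernel (Info ny nu k) (Vec nx) :=
  condDistrib (X (k + 1)) (infoVec Y U k) P

/-- The optimal estimator `E[X_k | I_k]`. -/
noncomputable def optEstimator (P : Measure Ω) (X : ℕ → Ω → Vec nx)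
    (Y : ℕ → Ω → Vec ny) (U : ℕ → Ω → Vec nu) (k : ℕ) : Ω → Vec nx :=
  P[X k | MeasurableSpace.comap (infoVec Y U k) inferInstance]

/-- The optimal total mean square error `E‖X_k - E[X_k | I_k]‖²`. -/
noncomputable def optTotalMSE (P : Measure Ω) (X : ℕ → Ω → Vec nx)
    (Y : ℕ → Ω → Vec ny) (U : ℕ → Ω → Vec nu) (k : ℕ) : ℝ≥0∞ :=
  ∫⁻ ω, ‖X k ω - optEstimator P X Y U k ω‖ₑ ^ 2 ∂P

/-- `‖φ_j‖_{k,2} = max(1, ⟨μ_0, |φ_j|²⟩^{1/2}, …, ⟨μ_k, |φ_j|²⟩^{1/2})` with `φ_j(x) = x_j`,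
a random variable through `I_0, …, I_k`. -/
noncomputable def coordNorm (P : Measure Ω) [IsFiniteMeasure P] (X : ℕ → Ω → Vec nx)
    (Y : ℕ → Ω → Vec ny) (U : ℕ → Ω → Vec nu) (k : ℕ) (j : Fin nx) (ω : Ω) : ℝ≥0∞ :=
  max 1 (⨆ l : Fin (k + 1),
    (∫⁻ x, ‖x j‖ₑ ^ 2 ∂(filterLaw P X Y U l (infoVec Y U l ω))) ^ (1 / 2 : ℝ))

end Filter

/-! ## The particle filter with selection

Particles are drawn independently from `μ_0` at time `0`. The step to time `k + 1` proposes
independent particles `x̄_i ∼ ∑_j a_{ij} K(dz, x_j, u_k)` for a doubly stochastic matrix `a` (the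
identity: every particle moves by `K`), repeats this until the average likelihood
`(1/N) ∑ ρ(y_{k+1}, x̄_i)` reaches a threshold, weights the accepted particles by their likelihoods
and resamples `N` particles independently from the weighted particles. -/

section Particles

/-- Product kernel: `a ↦ ⨂ᵢ κᵢ(a)`. -/
noncomputable def piKernel {A ι B : Type*} [Fintype ι] [MeasurableSpace A] [MeasurableSpace B]
    (κ : ι → Kernel A B) [∀ i, IsMarkovKernel (κ i)] : Kernel A (ι → B) where
  toFun a := Measure.pi fun i => κ i a
  measurable' := by
    refine Measurable.measure_of_isPiSystem_of_isProbabilityMeasure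
      generateFrom_pi.symm isPiSystem_pi ?_
    rintro _ ⟨s, hs, rfl⟩
    simp only [Measure.pi_pi]
    exact Finset.measurable_prod _ fun i _ =>
      Kernel.measurable_coe (κ i) (hs i (Set.mem_univ i))

instance {A ι B : Type*} [Fintype ι] [MeasurableSpace A] [MeasurableSpace B]
    (κ : ι → Kernel A B) [∀ i, IsMarkovKernel (κ i)] : IsMarkovKernel (piKernel κ) :=
  ⟨fun a => inferInstanceAs (IsProbabilityMeasure (Measure.pi fun i => κ i a))⟩

namespace ControlledSystem

variable {nx nu nξ ny nη : ℕ} (M : ControlledSystem nx nu nξ ny nη)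

/-- The transition kernel `(x, u) ↦ K(z, x, u) dz`. -/
noncomputable def transition : Kernel (Vec nx × Vec nu) (Vec nx) :=
  Kernel.withDensity (Kernel.const _ volume) fun p z => (M.K z p.1 p.2 : ℝ≥0∞)

lemma measurable_K_uncurry : Measurable
    (Function.uncurry fun (p : Vec nx × Vec nu) (z : Vec nx) => (M.K z p.1 p.2 : ℝ≥0∞)) := by
  have h : Measurable fun q : (Vec nx × Vec nu) × Vec nx => M.K q.2 q.1.1 q.1.2 :=
    M.measurable_K.comp (f := fun q : (Vec nx × Vec nu) × Vec nx => (q.2, q.1.1, q.1.2))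
      (by fun_prop)
  exact h.coe_nnreal_ennreal

lemma transition_apply (x : Vec nx) (u : Vec nu) :
    M.transition (x, u) = M.pξ.map fun e => M.f x u e := by
  rw [transition, Kernel.withDensity_apply _ M.measurable_K_uncurry, M.law_f, Kernel.const_apply]

instance : IsMarkovKernel M.transition :=
  ⟨fun p => by
    rw [show p = (p.1, p.2) from rfl, transition_apply]
    refine Measure.isProbabilityMeasure_map (Measurable.aemeasurable ?_)
    exact M.measurable_f.comp (f := fun e => (p.1, p.2, e)) (by fun_prop)⟩

variable {N : ℕ}

/-- Law of the `i`-th proposed particle: `∑_j a_{ij} K(dz, x_j, u)`. -/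
noncomputable def proposeOne (a : doublyStochastic ℝ≥0 (Fin N)) (i : Fin N) :
    Kernel ((Fin N → Vec nx) × Vec nu) (Vec nx) where
  toFun p := ∑ j, a.1 i j • M.transition (p.1 j, p.2)
  measurable' := by
    refine Measure.measurable_of_measurable_coe _ fun s hs => ?_
    simp only [Measure.coe_finsetSum, Finset.sum_apply, Measure.smul_apply, ENNReal.smul_def,
      smul_eq_mul]
    refine Finset.measurable_sum _ fun j _ => Measurable.const_mul ?_ _
    exact (Kernel.measurable_coe M.transition hs).comp
      (f := fun p : (Fin N → Vec nx) × Vec nu => (p.1 j, p.2)) (by fun_prop)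

instance (a : doublyStochastic ℝ≥0 (Fin N)) (i : Fin N) : IsMarkovKernel (M.proposeOne a i) :=
  ⟨fun p => ⟨by
    have h := congrFun a.2.2.1 i
    simp only [Matrix.mulVec, dotProduct, Pi.one_apply, mul_one] at h
    change (∑ j, a.1 i j • M.transition (p.1 j, p.2)) Set.univ = 1
    simp only [Measure.coe_finsetSum, Finset.sum_apply, Measure.smul_apply, measure_univ,
      ENNReal.smul_def, smul_eq_mul, mul_one]
    exact_mod_cast h⟩⟩

/-- Prediction step: given the particles and the control, the proposed particles are independent. -/
noncomputable def propose (a : doublyStochastic ℝ≥0 (Fin N)) :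
    Kernel ((Fin N → Vec nx) × Vec nu) (Fin N → Vec nx) :=
  piKernel fun i => M.proposeOne a i

instance (a : doublyStochastic ℝ≥0 (Fin N)) : IsMarkovKernel (M.propose a) :=
  inferInstanceAs (IsMarkovKernel (piKernel _))

/-- `⟨μ^N, ρ(y, ·)⟩` for the empirical measure `μ^N` of the particles `x`. -/
noncomputable def avgLikelihood (y : Vec ny) (x : Fin N → Vec nx) : ℝ≥0 :=
  (∑ i, M.ρ y (x i)) / N

lemma measurable_avgLikelihood :
    Measurable fun p : Vec ny × (Fin N → Vec nx) => M.avgLikelihood p.1 p.2 := by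
  unfold avgLikelihood
  refine Measurable.div_const (Finset.measurable_sum _ fun i _ => ?_) _
  exact M.measurable_ρ.comp
    (f := fun p : Vec ny × (Fin N → Vec nx) => (p.1, p.2 i)) (by fun_prop)

/-- Proposals accepted by the selection step with threshold `t`. -/
def acceptSet (t : ℝ≥0) (y : Vec ny) : Set (Fin N → Vec nx) :=
  {x | t ≤ M.avgLikelihood y x}

lemma measurableSet_accept (t : ℝ≥0) : MeasurableSet
    {q : ((Fin N → Vec nx) × Vec nu × Vec ny) × (Fin N → Vec nx) |
      q.2 ∈ M.acceptSet t q.1.2.2} := by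
  exact measurableSet_le (measurable_const (a := t)) <| M.measurable_avgLikelihood.comp
    (f := fun q : ((Fin N → Vec nx) × Vec nu × Vec ny) × (Fin N → Vec nx) => (q.1.2.2, q.2))
    (by fun_prop)

lemma measurable_propose_accept (a : doublyStochastic ℝ≥0 (Fin N)) (t : ℝ≥0)
    {s : Set (Fin N → Vec nx)} (hs : MeasurableSet s) :
    Measurable fun p : (Fin N → Vec nx) × Vec nu × Vec ny =>
      M.propose a (p.1, p.2.1) (M.acceptSet t p.2.2 ∩ s) := by
  have hm : Measurable fun p : (Fin N → Vec nx) × Vec nu × Vec ny => (p.1, p.2.1) := by fun_prop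
  exact Kernel.measurable_kernel_prodMk_left (κ := (M.propose a).comap _ hm)
    ((M.measurableSet_accept t).inter (measurable_snd hs))

open scoped Classical in
/-- Prediction followed by selection, with input `(x, u, y)`: new proposals are drawn from the same
particles `x` until one is accepted, so that the outcome has the law of a proposal conditioned on
acceptance. Where acceptance has probability zero (the loop never ends), all particles are put at
the origin by convention. -/
noncomputable def select (a : doublyStochastic ℝ≥0 (Fin N)) (t : ℝ≥0) :
    Kernel ((Fin N → Vec nx) × Vec nu × Vec ny) (Fin N → Vec nx) where
  toFun p :=
    if M.propose a (p.1, p.2.1) (M.acceptSet t p.2.2) = 0 then Measure.dirac 0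
    else (M.propose a (p.1, p.2.1))[|M.acceptSet t p.2.2]
  measurable' := by
    have h1 : Measurable fun p : (Fin N → Vec nx) × Vec nu × Vec ny =>
        M.propose a (p.1, p.2.1) (M.acceptSet t p.2.2) := by
      simpa using M.measurable_propose_accept a t MeasurableSet.univ
    refine Measurable.ite (h1 (measurableSet_singleton 0)) measurable_const ?_
    refine Measure.measurable_of_measurable_coe _ fun s hs => ?_
    have h2 : ∀ y, MeasurableSet (M.acceptSet (N := N) t y) := fun y =>
      measurableSet_le measurable_const (M.measurable_avgLikelihood.comp
        (f := fun x : Fin N → Vec nx => (y, x)) (by fun_prop))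
    simp only [cond_apply (h2 _)]
    exact h1.inv.mul (M.measurable_propose_accept a t hs)

instance (a : doublyStochastic ℝ≥0 (Fin N)) (t : ℝ≥0) : IsMarkovKernel (M.select a t) :=
  ⟨fun p => by
    classical
    change IsProbabilityMeasure (if M.propose a (p.1, p.2.1) (M.acceptSet t p.2.2) = 0
      then Measure.dirac 0 else (M.propose a (p.1, p.2.1))[|M.acceptSet t p.2.2])
    split_ifs with h
    · infer_instance
    · exact cond_isProbabilityMeasure h⟩

open scoped Classical in
/-- Normalised importance weights `ρ(y, x_i) / ∑_l ρ(y, x_l)` (uniform if all likelihoods vanish). -/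
noncomputable def weight (y : Vec ny) (x : Fin N → Vec nx) (i : Fin N) : ℝ≥0 :=
  if ∑ l, M.ρ y (x l) = 0 then 1 / N else M.ρ y (x i) / ∑ l, M.ρ y (x l)

lemma measurable_weight (i : Fin N) :
    Measurable fun p : (Fin N → Vec nx) × Vec ny => M.weight p.2 p.1 i := by
  have h : ∀ l, Measurable fun p : (Fin N → Vec nx) × Vec ny => M.ρ p.2 (p.1 l) := fun l =>
    M.measurable_ρ.comp (f := fun p : (Fin N → Vec nx) × Vec ny => (p.2, p.1 l)) (by fun_prop)
  have hs := Finset.measurable_sum Finset.univ fun l _ => h l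
  exact Measurable.ite (hs (measurableSet_singleton 0)) measurable_const ((h i).div hs)

/-- Law of the `i`-th resampled particle: the weighted empirical measure `∑_j w_j δ_{x_j}` of the
corrected particles (the same for every `i`). -/
noncomputable def resampleOne (_i : Fin N) : Kernel ((Fin N → Vec nx) × Vec ny) (Vec nx) where
  toFun p := ∑ j, M.weight p.2 p.1 j • Measure.dirac (p.1 j)
  measurable' := by
    refine Measure.measurable_of_measurable_coe _ fun s hs => ?_
    simp only [Measure.coe_finsetSum, Finset.sum_apply, Measure.smul_apply, ENNReal.smul_def,
      smul_eq_mul]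
    refine Finset.measurable_sum _ fun j _ =>
      (M.measurable_weight j).coe_nnreal_ennreal.mul ?_
    exact (Measure.measurable_coe hs).comp (Measure.measurable_dirac.comp (by fun_prop))

instance (i : Fin N) : IsMarkovKernel (M.resampleOne i) :=
  ⟨fun p => ⟨by
    change (∑ j, M.weight p.2 p.1 j • Measure.dirac (p.1 j)) Set.univ = 1
    simp only [Measure.coe_finsetSum, Finset.sum_apply, Measure.smul_apply, measure_univ,
      ENNReal.smul_def, smul_eq_mul, mul_one]
    have h : ∑ j, M.weight p.2 p.1 j = 1 := by
      by_cases h0 : ∑ l, M.ρ p.2 (p.1 l) = 0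
      · simp only [weight, h0, if_true]
        simp [i.pos.ne']
      · simp only [weight, h0, if_false]
        rw [← Finset.sum_div, div_self h0]
    exact_mod_cast h⟩⟩

/-- Correction and resampling: `N` independent draws from the weighted empirical measure. -/
noncomputable def resample :
    Kernel ((Fin N → Vec nx) × Vec ny) (Fin N → Vec nx) :=
  piKernel fun i => M.resampleOne i

instance : IsMarkovKernel (M.resample (N := N)) :=
  inferInstanceAs (IsMarkovKernel (piKernel _))

/-- One full step `(x, u_k, y_{k+1}) ↦` law of the particles at time `k + 1`. -/
noncomputable def filterStep (a : doublyStochastic ℝ≥0 (Fin N)) (t : ℝ≥0) :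
    Kernel ((Fin N → Vec nx) × Vec nu × Vec ny) (Fin N → Vec nx) :=
  M.resample ∘ₖ (M.select a t ×ₖ
    Kernel.deterministic (fun p : (Fin N → Vec nx) × Vec nu × Vec ny => p.2.2) (by fun_prop))

instance (a : doublyStochastic ℝ≥0 (Fin N)) (t : ℝ≥0) :
    IsMarkovKernel (M.filterStep a t) := by
  unfold filterStep; infer_instance

/-- The conditional law of the `N` (equally weighted) particles at time `k` given `I_k = i_k`.
At time `0` they are independent draws from the filtering distribution `μ₀`; the step to time `k`
uses the mixing matrix `a k` and the selection threshold `t k`. -/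
noncomputable def particleLaw (μ₀ : Kernel (Info ny nu 0) (Vec nx)) [IsMarkovKernel μ₀]
    (a : ℕ → doublyStochastic ℝ≥0 (Fin N)) (t : ℕ → ℝ≥0) :
    (k : ℕ) → Kernel (Info ny nu k) (Fin N → Vec nx)
  | 0 => piKernel fun _ => μ₀
  | k + 1 => M.filterStep (a (k + 1)) (t (k + 1)) ∘ₖ
      ((particleLaw μ₀ a t k).comap Info.prev Info.measurable_prev ×ₖ
        Kernel.deterministic Info.last Info.measurable_last)

instance (μ₀ : Kernel (Info ny nu 0) (Vec nx)) [IsMarkovKernel μ₀]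
    (a : ℕ → doublyStochastic ℝ≥0 (Fin N)) (t : ℕ → ℝ≥0) (k : ℕ) :
    IsMarkovKernel (M.particleLaw μ₀ a t k) := by
  induction k with
  | zero => exact inferInstanceAs (IsMarkovKernel (piKernel _))
  | succ k ih => unfold particleLaw; infer_instance

/-- The conditional law, given `I_{k+1}`, of the first proposal (before selection) for time `k + 1`,
i.e. of the particles of `μ^N_{k+1|k}`. -/
noncomputable def proposalLaw (μ₀ : Kernel (Info ny nu 0) (Vec nx)) [IsMarkovKernel μ₀]
    (a : ℕ → doublyStochastic ℝ≥0 (Fin N)) (t : ℕ → ℝ≥0) (k : ℕ) :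
    Kernel (Info ny nu (k + 1)) (Fin N → Vec nx) :=
  M.propose (a (k + 1)) ∘ₖ
    ((M.particleLaw μ₀ a t k).comap Info.prev Info.measurable_prev ×ₖ
      Kernel.deterministic (fun i => (Info.last i).1) (measurable_fst.comp Info.measurable_last))

end ControlledSystem

/-- The empirical mean `(1/N) ∑ x_i` of the particles. -/
noncomputable def particleMean {nx N : ℕ} (x : Fin N → Vec nx) : Vec nx :=
  (N : ℝ)⁻¹ • ∑ i, x i

/-- The total mean square error `E‖X_k - X̂_k^N‖²`, the expectation being taken also over the
particles, whose conditional law given `I_k` (and `X_k`) is `κ(I_k)`. -/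
noncomputable def particleTotalMSE {Ω : Type*} [MeasurableSpace Ω] {nx nu ny N : ℕ}
    (P : Measure Ω) (X : ℕ → Ω → Vec nx) (Y : ℕ → Ω → Vec ny) (U : ℕ → Ω → Vec nu) (k : ℕ)
    (κ : Kernel (Info ny nu k) (Fin N → Vec nx)) : ℝ≥0∞ :=
  ∫⁻ ω, ∫⁻ x, ‖X k ω - particleMean x‖ₑ ^ 2 ∂(κ (infoVec Y U k ω)) ∂P

end Particles

/-! ## Assumptions and the error bound -/

section Assumptions

variable {Ω : Type*} [MeasurableSpace Ω] {nx nu nξ ny nη : ℕ}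

/-- The particle filter with `N` particles, started from `μ_0`, with selection thresholds
`γ_k / 2`. -/
noncomputable def particleFilter (M : ControlledSystem nx nu nξ ny nη) (P : Measure Ω)
    [IsFiniteMeasure P] (X : ℕ → Ω → Vec nx) (Y : ℕ → Ω → Vec ny) (U : ℕ → Ω → Vec nu)
    (γ : ℕ → ℝ≥0) {N : ℕ} (a : ℕ → doublyStochastic ℝ≥0 (Fin N)) (k : ℕ) :
    Kernel (Info ny nu k) (Fin N → Vec nx) :=
  M.particleLaw (filterLaw P X Y U 0) a (fun l => γ l / 2) k

/-- For `k ≥ 1` and a.a. `i_k`: `⟨μ_{k|k-1}, ρ(y_k, ·)⟩ ≥ γ_k`, and for `N ≥ N_k(i_k)`,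
`P(⟨μ^N_{k|k-1}, ρ(y_k, ·)⟩ > γ_k | I_k = i_k) ≥ 1 - ε_k`. -/
structure LikelihoodBoundedBelow (M : ControlledSystem nx nu nξ ny nη) (P : Measure Ω)
    [IsFiniteMeasure P] (X : ℕ → Ω → Vec nx) (Y : ℕ → Ω → Vec ny) (U : ℕ → Ω → Vec nu)
    (γ : ℕ → ℝ≥0) (ε : ℕ → ℝ) (a : (N : ℕ) → ℕ → doublyStochastic ℝ≥0 (Fin N)) : Prop where
  predicted : ∀ k, ∀ᵐ ω ∂P, (γ (k + 1) : ℝ≥0∞) ≤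
    ∫⁻ x, (M.ρ (Y (k + 1) ω) x : ℝ≥0∞) ∂(predictedLaw P X Y U k (infoVec Y U k ω))
  particles : ∀ k, ∀ᵐ ω ∂P, ∃ N₀ : ℕ, 0 < N₀ ∧ ∀ N, N₀ ≤ N →
    ENNReal.ofReal (1 - ε (k + 1)) ≤
      M.proposalLaw (filterLaw P X Y U 0) (a N) (fun l => γ l / 2) k (infoVec Y U (k + 1) ω)
        {x | γ (k + 1) < M.avgLikelihood (Y (k + 1) ω) x}

/-- `‖K‖_∞ ≤ BK`, `‖ρ‖_∞ ≤ Bρ` and `‖ρ φ_j²‖_∞ ≤ Bφ j` for all `j`, with finite bounds. -/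
structure UniformlyBounded (M : ControlledSystem nx nu nξ ny nη)
    (BK Bρ : ℝ≥0) (Bφ : Fin nx → ℝ≥0) : Prop where
  bound_K : (⨆ z, ⨆ x, ⨆ u ∈ M.𝒰, (M.K z x u : ℝ≥0∞)) ≤ BK
  bound_ρ : (⨆ x, ⨆ y, (M.ρ y x : ℝ≥0∞)) ≤ Bρ
  bound_φ : ∀ j, (⨆ x : Vec nx, ⨆ y, ‖x j‖ₑ ^ 2 * (M.ρ y x : ℝ≥0∞)) ≤ Bφ j

/-- `(1 + N^{-q}) e^tot_{k,*} + (1 + N^q) (∑_j C_{k,j} E[‖φ_j‖²_{k,2}]) / N`. -/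
noncomputable def totalMSEBound (P : Measure Ω) [IsFiniteMeasure P] (X : ℕ → Ω → Vec nx)
    (Y : ℕ → Ω → Vec ny) (U : ℕ → Ω → Vec nu) (C : ℕ → Fin nx → ℝ≥0) (q : ℝ) (k N : ℕ) : ℝ≥0∞ :=
  (1 + 1 / (N : ℝ≥0∞) ^ q) * optTotalMSE P X Y U k +
    (1 + (N : ℝ≥0∞) ^ q) *
      ((∑ j, (C k j : ℝ≥0∞) * ∫⁻ ω, coordNorm P X Y U k j ω ^ 2 ∂P) / N)

end Assumptions

/-!
The filtering law given `I_k` has mean `E[X_k | I_k]`, and given `I_k` the particles are independent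
of `X_k`. Hence the error of the particle estimate splits exactly into the optimal error and the mean
squared distance between the particle mean and the filtered mean (`particleTotalMSE_eq`). This gives
the lower bound, and reduces the upper bound and the limit to showing that the second term is
`O(1/N)`, with constants that depend only on the data.

By independence of the noises, for almost every trajectory the filtering laws obey the recursion
"move by the transition kernel, then reweight by the likelihood" (`IsClosedLoop.predictedLaw_eq`,
`IsClosedLoop.filterLaw_succ_eq`), with normalising constants at least `γ_k`. For such a trajectory
one shows, by induction on `k`, that `E(⟨μ^N_k, φ⟩ - ⟨μ_k, φ⟩)² ≤ c_k β / N` for all test functions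
with `φ² ≤ β` (`IsFilterRecursion.hasMeanSquareError`). One step consists of three parts.

* Prediction: as the columns of the mixing matrix sum to one, the proposals are unbiased for the
  mean predicted from the particles, and they are independent (`sqErr_propose_le`).
* Selection: where acceptance has probability at least `1/2`, conditioning on it at most doubles
  integrals. The remaining part is controlled by the rejection probability, and this is `O(1/N)` by
  Chebyshev's inequality, since the predicted mean of the likelihood is at least `γ_k`, twice the
  threshold (`lintegral_select_le`).
* Correction and resampling: on accepted proposals the weighted mean of `φ` is the ratio of the
  empirical means of `ρφ` and `ρ`, with denominator at least `γ_k / 2`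
  (`lintegral_sqErr_resample_select_le`).

The step only needs `ρ φ²` bounded, since it tests the preceding particles with the functions `ρφ`
and `ρ`, which then are bounded. So the induction runs over bounded test functions, and one further
step from them covers the unbounded coordinates `φ_j` (`IsFilterRecursion.sqErr_succ_le`). At time
`0` the particles are a sample from `μ_0`, and the error is at most `⟨μ_0, φ_j²⟩ / N`.
-/

/-! ### Independence of the noise from the past -/

/-- Contraction: if `X` is independent of `Y` and `(X, Y)` of `Z`, then `X` is independent of
`(Y, Z)`. -/
lemma indepFun_prodMk_of_contraction {Ω α β δ : Type*} [MeasurableSpace Ω] [MeasurableSpace α]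
    [MeasurableSpace β] [MeasurableSpace δ] {P : Measure Ω} [IsProbabilityMeasure P]
    {X : Ω → α} {Y : Ω → β} {Z : Ω → δ} (hX : Measurable X) (hY : Measurable Y) (hZ : Measurable Z)
    (hXY : IndepFun X Y P) (hXYZ : IndepFun (fun ω => (X ω, Y ω)) Z P) :
    IndepFun X (fun ω => (Y ω, Z ω)) P := by
  have := Measure.isProbabilityMeasure_map (μ := P) hX.aemeasurable
  have := Measure.isProbabilityMeasure_map (μ := P) hY.aemeasurable
  have := Measure.isProbabilityMeasure_map (μ := P) hZ.aemeasurable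
  have hYZ : IndepFun Y Z P := hXYZ.comp measurable_snd measurable_id
  rw [indepFun_iff_map_prod_eq_prod_map_map (by fun_prop) (by fun_prop)] at *
  rw [hYZ, ← Measure.prodAssoc_prod, ← hXY, ← hXYZ,
    Measure.map_map (by fun_prop) (by fun_prop)]
  rfl

/-- A random variable independent of `W` is integrated out against its own law. -/
lemma lintegral_comp_of_indepFun {Ω α β : Type*} [MeasurableSpace Ω] [MeasurableSpace α]
    [MeasurableSpace β] {P : Measure Ω} [IsProbabilityMeasure P] {W : Ω → α} {e : Ω → β}
    (hW : Measurable W) (he : Measurable e) (h : IndepFun W e P) {g : α × β → ℝ≥0∞}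
    (hg : Measurable g) :
    ∫⁻ ω, g (W ω, e ω) ∂P = ∫⁻ ω, ∫⁻ v, g (W ω, v) ∂(P.map e) ∂P := by
  have := Measure.isProbabilityMeasure_map (μ := P) he.aemeasurable
  rw [indepFun_iff_map_prod_eq_prod_map_map (by fun_prop) (by fun_prop)] at h
  rw [← lintegral_map (f := g) (g := fun ω => (W ω, e ω)) hg (by fun_prop), h,
    lintegral_prod _ hg.aemeasurable,
    lintegral_map (f := fun w => ∫⁻ v, g (w, v) ∂(P.map e)) hg.lintegral_prod_right' hW]

namespace IsClosedLoop

variable {Ω : Type*} {mΩ : MeasurableSpace Ω} {nx nu nξ ny nη : ℕ}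
  {M : ControlledSystem nx nu nξ ny nη} {P : Measure Ω}
  {π : (k : ℕ) → Info ny nu k → Vec nu}
  {X : ℕ → Ω → Vec nx} {Y : ℕ → Ω → Vec ny} {U : ℕ → Ω → Vec nu}
  {ξ : ℕ → Ω → Vec nξ} {η : ℕ → Ω → Vec nη}

/-- `X_k` is measurable with respect to every σ-algebra that makes `X_0` and the noises before
time `k` measurable, and so are the observations and controls before time `k`. -/
lemma measurable_state (h : IsClosedLoop M P π X Y U ξ η) (m : MeasurableSpace Ω)
    (h0 : Measurable[m] (X 0)) (k : ℕ) (hξ : ∀ j < k, Measurable[m] (ξ j))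
    (hη : ∀ j < k, Measurable[m] (η j)) :
    Measurable[m] (X k) ∧ ∀ j < k, Measurable[m] (Y j) ∧ Measurable[m] (U j) := by
  obtain ⟨hπ, -, -, -, -, -, -, -, -, -, -, -, hdyn, hobs, hctl⟩ := h
  induction k with
  | zero => exact ⟨h0, by simp⟩
  | succ k ih =>
    obtain ⟨hX, hYU⟩ := ih (fun j hj => hξ j (by omega)) (fun j hj => hη j (by omega))
    have hY : Measurable[m] (Y k) := by
      rw [funext (hobs k)]
      exact M.measurable_h.comp (hX.prodMk (hη k (by omega)))
    have hY' : ∀ j ≤ k, Measurable[m] (Y j) := fun j hj => by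
      rcases hj.lt_or_eq with hj | rfl
      exacts [(hYU j hj).1, hY]
    have hI : Measurable[m] (infoVec Y U k) :=
      Measurable.prodMk (measurable_pi_lambda _ fun j => hY' j (by omega))
        (measurable_pi_lambda _ fun j => (hYU j j.2).2)
    have hU : Measurable[m] (U k) := by
      rw [funext (hctl k)]
      exact (hπ k).comp hI
    refine ⟨?_, fun j hj => ?_⟩
    · rw [funext (hdyn k)]
      exact M.measurable_f.comp (hX.prodMk (hU.prodMk (hξ k (by omega))))
    · rcases (Nat.lt_succ_iff.1 hj).lt_or_eq with hj | rfl
      exacts [hYU j hj, ⟨hY, hU⟩]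

lemma measurable_infoVec_of (h : IsClosedLoop M P π X Y U ξ η) (m : MeasurableSpace Ω)
    (h0 : Measurable[m] (X 0)) (k : ℕ) (hξ : ∀ j < k, Measurable[m] (ξ j))
    (hη : ∀ j ≤ k, Measurable[m] (η j)) : Measurable[m] (infoVec Y U k) := by
  obtain ⟨hX, hYU⟩ := h.measurable_state m h0 k hξ fun j hj => hη j hj.le
  have hY : Measurable[m] (Y k) := by
    obtain ⟨-, -, -, -, -, -, -, -, -, -, -, -, -, hobs, -⟩ := h
    rw [funext (hobs k)]
    exact M.measurable_h.comp (hX.prodMk (hη k le_rfl))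
  refine Measurable.prodMk (measurable_pi_lambda _ fun j => ?_)
    (measurable_pi_lambda _ fun j => (hYU j j.2).2)
  rcases (Nat.lt_succ_iff.1 j.2).lt_or_eq with hj | hj
  · exact (hYU j hj).1
  · change Measurable[m] (Y j)
    rwa [hj]

lemma measurable_X (h : IsClosedLoop M P π X Y U ξ η) (k : ℕ) : Measurable (X k) :=
  (h.measurable_state mΩ h.measurable_init k (fun j _ => h.measurable_ξ j)
    fun j _ => h.measurable_η j).1

lemma measurable_infoVec (h : IsClosedLoop M P π X Y U ξ η) (k : ℕ) :
    Measurable (infoVec Y U k) :=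
  h.measurable_infoVec_of mΩ h.measurable_init k (fun j _ => h.measurable_ξ j)
    fun j _ => h.measurable_η j

variable [IsProbabilityMeasure P]

/-- The process noise `ξ_k` is independent of `(I_k, X_k)`. -/
lemma indepFun_ξ (h : IsClosedLoop M P π X Y U ξ η) (k : ℕ) :
    IndepFun (fun ω => (infoVec Y U k ω, X k ω)) (ξ k) P := by
  have mξ := h.measurable_ξ
  have mη := h.measurable_η
  have mi := h.measurable_init
  let A : Ω → ((i : Finset.range k) → Vec nξ) := fun ω i => ξ i ω
  let B : Ω → ℕ → Vec nη := fun ω j => η j ω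
  have hk : Measurable fun v : ((i : ({k} : Finset ℕ)) → Vec nξ) => v ⟨k, by simp⟩ :=
    measurable_pi_apply _
  have i1 : IndepFun (ξ k) A P :=
    ((h.indep_ξ.indepFun_finset {k} (Finset.range k) (by simp) mξ).comp
      (φ := fun v : ((i : ({k} : Finset ℕ)) → Vec nξ) => v ⟨k, by simp⟩) hk
      measurable_id :)
  have i2 : IndepFun (fun ω => (ξ k ω, A ω)) B P :=
    h.indep_ξ_η.comp (φ := fun v : ℕ → Vec nξ => (v k, fun i : Finset.range k => v i))
      (ψ := fun v => v) (by fun_prop) (by fun_prop)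
  have i3 := indepFun_prodMk_of_contraction (mξ k) (by fun_prop) (by fun_prop) i1 i2
  have i4 : IndepFun (fun ω => (ξ k ω, (A ω, B ω))) (X 0) P :=
    h.indep_init.symm.comp
      (φ := fun v : (ℕ → Vec nξ) × (ℕ → Vec nη) => (v.1 k, ((fun i : Finset.range k => v.1 i), v.2)))
      (ψ := fun v => v) (by fun_prop) (by fun_prop)
  have i5 := (indepFun_prodMk_of_contraction (mξ k) (by fun_prop) mi i3 i4).symm
  set W : Ω → (((i : Finset.range k) → Vec nξ) × (ℕ → Vec nη)) × Vec nx :=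
    fun ω => ((A ω, B ω), X 0 ω)
  let m : MeasurableSpace Ω := MeasurableSpace.comap W inferInstance
  have hW : Measurable[m] W := comap_measurable W
  have hA : Measurable[m] fun ω => (W ω).1.1 := (measurable_fst.comp measurable_fst).comp hW
  have hB : Measurable[m] fun ω => (W ω).1.2 := (measurable_snd.comp measurable_fst).comp hW
  have h0 : Measurable[m] (X 0) := measurable_snd.comp hW
  have hξ : ∀ j < k, Measurable[m] (ξ j) := fun j hj =>
    (measurable_pi_apply (⟨j, Finset.mem_range.2 hj⟩ : Finset.range k)).comp hA
  have hη : ∀ j, Measurable[m] (η j) := fun j => (measurable_pi_apply j).comp hB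
  refine indep_of_indep_of_le_left i5 (Measurable.comap_le ?_)
  exact (h.measurable_infoVec_of m h0 k hξ fun j _ => hη j).prodMk
    (h.measurable_state m h0 k hξ fun j _ => hη j).1

/-- The observation noise `η_{k+1}` is independent of `(I_k, X_{k+1})`. -/
lemma indepFun_η (h : IsClosedLoop M P π X Y U ξ η) (k : ℕ) :
    IndepFun (fun ω => (infoVec Y U k ω, X (k + 1) ω)) (η (k + 1)) P := by
  have mξ := h.measurable_ξ
  have mη := h.measurable_η
  have mi := h.measurable_init
  let A : Ω → ((i : Finset.range (k + 1)) → Vec nη) := fun ω i => η i ω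
  let B : Ω → ℕ → Vec nξ := fun ω j => ξ j ω
  have hk : Measurable fun v : ((i : ({k + 1} : Finset ℕ)) → Vec nη) => v ⟨k + 1, by simp⟩ :=
    measurable_pi_apply _
  have i1 : IndepFun (η (k + 1)) A P :=
    ((h.indep_η.indepFun_finset {k + 1} (Finset.range (k + 1)) (by simp) mη).comp
      (φ := fun v : ((i : ({k + 1} : Finset ℕ)) → Vec nη) => v ⟨k + 1, by simp⟩) hk
      measurable_id :)
  have i2 : IndepFun (fun ω => (η (k + 1) ω, A ω)) B P :=
    h.indep_ξ_η.symm.comp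
      (φ := fun v : ℕ → Vec nη => (v (k + 1), fun i : Finset.range (k + 1) => v i))
      (ψ := fun v => v) (by fun_prop) (by fun_prop)
  have i3 := indepFun_prodMk_of_contraction (mη (k + 1)) (by fun_prop) (by fun_prop) i1 i2
  have i4 : IndepFun (fun ω => (η (k + 1) ω, (A ω, B ω))) (X 0) P :=
    h.indep_init.symm.comp
      (φ := fun v : (ℕ → Vec nξ) × (ℕ → Vec nη) =>
        (v.2 (k + 1), ((fun i : Finset.range (k + 1) => v.2 i), v.1)))
      (ψ := fun v => v) (by fun_prop) (by fun_prop)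
  have i5 := (indepFun_prodMk_of_contraction (mη (k + 1)) (by fun_prop) mi i3 i4).symm
  set W : Ω → (((i : Finset.range (k + 1)) → Vec nη) × (ℕ → Vec nξ)) × Vec nx :=
    fun ω => ((A ω, B ω), X 0 ω)
  let m : MeasurableSpace Ω := MeasurableSpace.comap W inferInstance
  have hW : Measurable[m] W := comap_measurable W
  have hA : Measurable[m] fun ω => (W ω).1.1 := (measurable_fst.comp measurable_fst).comp hW
  have hB : Measurable[m] fun ω => (W ω).1.2 := (measurable_snd.comp measurable_fst).comp hW
  have h0 : Measurable[m] (X 0) := measurable_snd.comp hW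
  have hη : ∀ j ≤ k, Measurable[m] (η j) := fun j hj =>
    (measurable_pi_apply (⟨j, Finset.mem_range.2 (by omega)⟩ : Finset.range (k + 1))).comp hA
  have hξ : ∀ j, Measurable[m] (ξ j) := fun j => (measurable_pi_apply j).comp hB
  refine indep_of_indep_of_le_left i5 (Measurable.comap_le ?_)
  exact (h.measurable_infoVec_of m h0 k (fun j _ => hξ j) hη).prodMk
    (h.measurable_state m h0 (k + 1) (fun j _ => hξ j) fun j hj => hη j (by omega)).1

end IsClosedLoop

/-! ### The recursion of the filter -/

lemma lintegral_condDistrib {Ω α β : Type*} [MeasurableSpace Ω] [MeasurableSpace α]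
    [MeasurableSpace β] [StandardBorelSpace β] [Nonempty β] {P : Measure Ω} [IsProbabilityMeasure P]
    {I : Ω → α} {Z : Ω → β} (hI : Measurable I) (hZ : Measurable Z)
    {g : α × β → ℝ≥0∞} (hg : Measurable g) :
    ∫⁻ ω, g (I ω, Z ω) ∂P = ∫⁻ ω, ∫⁻ z, g (I ω, z) ∂(condDistrib Z I P (I ω)) ∂P := by
  rw [← lintegral_map (f := g) (g := fun ω => (I ω, Z ω)) hg (by fun_prop),
    ← compProd_map_condDistrib (μ := P) (X := I) hZ.aemeasurable,
    Measure.lintegral_compProd hg, lintegral_map _ hI]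
  exact hg.lintegral_kernel_prod_right'

instance {Ω : Type*} [MeasurableSpace Ω] {nx nu ny : ℕ} (P : Measure Ω) [IsFiniteMeasure P]
    (X : ℕ → Ω → Vec nx) (Y : ℕ → Ω → Vec ny) (U : ℕ → Ω → Vec nu) (k : ℕ) :
    IsMarkovKernel (predictedLaw P X Y U k) :=
  inferInstanceAs (IsMarkovKernel (condDistrib (X (k + 1)) (infoVec Y U k) P))

/-- A kernel that disintegrates the joint law of `(I, Z)` is the conditional law of `Z`
given `I`. -/
lemma condDistrib_ae_eq_of_lintegral {Ω α β : Type*} [MeasurableSpace Ω] [MeasurableSpace α]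
    [MeasurableSpace β] [StandardBorelSpace β] [Nonempty β] {P : Measure Ω} [IsProbabilityMeasure P]
    {I : Ω → α} {Z : Ω → β} (hI : Measurable I) (hZ : Measurable Z) (κ : Kernel α β)
    [IsFiniteKernel κ]
    (h : ∀ g : α × β → ℝ≥0∞, Measurable g →
      ∫⁻ ω, g (I ω, Z ω) ∂P = ∫⁻ ω, ∫⁻ z, g (I ω, z) ∂(κ (I ω)) ∂P) :
    ∀ᵐ ω ∂P, condDistrib Z I P (I ω) = κ (I ω) := by
  refine ae_of_ae_map hI.aemeasurable
    (condDistrib_ae_eq_of_measure_eq_compProd I hZ.aemeasurable ?_)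
  refine Measure.ext_of_lintegral _ fun g hg => ?_
  rw [lintegral_map hg (by fun_prop), h g hg, Measure.lintegral_compProd hg, lintegral_map _ hI]
  exact hg.lintegral_kernel_prod_right'

namespace IsClosedLoop

variable {Ω : Type*} [MeasurableSpace Ω] {nx nu nξ ny nη : ℕ}
  {M : ControlledSystem nx nu nξ ny nη} {P : Measure Ω} [IsProbabilityMeasure P]
  {π : (k : ℕ) → Info ny nu k → Vec nu}
  {X : ℕ → Ω → Vec nx} {Y : ℕ → Ω → Vec ny} {U : ℕ → Ω → Vec nu}
  {ξ : ℕ → Ω → Vec nξ} {η : ℕ → Ω → Vec nη}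

/-- Chapman–Kolmogorov: the predicted law is the filtering law moved by the transition kernel. -/
lemma predictedLaw_eq (h : IsClosedLoop M P π X Y U ξ η) (k : ℕ) :
    ∀ᵐ ω ∂P, predictedLaw P X Y U k (infoVec Y U k ω) =
      (filterLaw P X Y U k (infoVec Y U k ω)).bind fun x => M.transition (x, U k ω) := by
  have mI := h.measurable_infoVec k
  have mX := h.measurable_X
  have mπ := h.measurable_policy k
  let κ : Kernel (Info ny nu k) (Vec nx) :=
    M.transition ∘ₖ (filterLaw P X Y U k ×ₖ Kernel.deterministic (π k) mπ)
  have hκ : ∀ (i : Info ny nu k) (f : Vec nx → ℝ≥0∞), Measurable f → ∫⁻ z, f z ∂(κ i) =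
      ∫⁻ x, ∫⁻ z, f z ∂(M.transition (x, π k i)) ∂(filterLaw P X Y U k i) := fun i f hf => by
    rw [Kernel.lintegral_comp _ _ _ hf, Kernel.lintegral_prod_deterministic]
    exact hf.lintegral_kernel
  have key : ∀ᵐ ω ∂P, predictedLaw P X Y U k (infoVec Y U k ω) = κ (infoVec Y U k ω) := by
    refine condDistrib_ae_eq_of_lintegral mI (mX (k + 1)) κ fun g hg => ?_
    have m1 : Measurable fun p : (Info ny nu k × Vec nx) × Vec nξ =>
        g (p.1.1, M.f p.1.2 (π k p.1.1) p.2) :=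
      hg.comp ((by fun_prop : Measurable fun p : (Info ny nu k × Vec nx) × Vec nξ => p.1.1).prodMk
        (M.measurable_f.comp (f := fun p : (Info ny nu k × Vec nx) × Vec nξ =>
          (p.1.2, π k p.1.1, p.2)) (by fun_prop)))
    have m2 : ∀ i x, Measurable fun e => M.f x (π k i) e := fun i x =>
      M.measurable_f.comp (f := fun e => (x, π k i, e)) (by fun_prop)
    have e1 : ∀ i x, ∫⁻ e, g (i, M.f x (π k i) e) ∂M.pξ =
        ∫⁻ z, g (i, z) ∂(M.transition (x, π k i)) := fun i x => by
      rw [M.transition_apply, lintegral_map (by fun_prop) (m2 i x)]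
    have m3 : Measurable fun p : Info ny nu k × Vec nx =>
        ∫⁻ e, g (p.1, M.f p.2 (π k p.1) e) ∂M.pξ := m1.lintegral_prod_right'
    calc ∫⁻ ω, g (infoVec Y U k ω, X (k + 1) ω) ∂P
        = ∫⁻ ω, g (infoVec Y U k ω, M.f (X k ω) (π k (infoVec Y U k ω)) (ξ k ω)) ∂P := by
          refine lintegral_congr fun ω => ?_
          rw [h.dynamics, h.control k ω]
      _ = ∫⁻ ω, ∫⁻ e, g (infoVec Y U k ω, M.f (X k ω) (π k (infoVec Y U k ω)) e) ∂M.pξ ∂P := by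
          rw [← h.law_ξ k]
          exact lintegral_comp_of_indepFun (mI.prodMk (mX k)) (h.measurable_ξ k) (h.indepFun_ξ k) m1
      _ = _ := by
          rw [lintegral_condDistrib mI (mX k) m3]
          refine lintegral_congr fun ω => ?_
          rw [hκ _ _ (by fun_prop)]
          exact lintegral_congr fun x => e1 _ _
  filter_upwards [key] with ω hω
  rw [hω]
  refine Measure.ext_of_lintegral _ fun f hf => ?_
  rw [hκ _ _ hf, Measure.lintegral_bind _ hf.aemeasurable, h.control k ω]
  exact (M.transition.measurable.comp (by fun_prop)).aemeasurable

/-- Bayes' formula: the filtering law at time `k + 1` has density proportional to the likelihood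
with respect to the predicted law. -/
lemma filterLaw_succ_eq (h : IsClosedLoop M P π X Y U ξ η) {Bρ : ℝ≥0}
    (hρ : ∀ y x, M.ρ y x ≤ Bρ) (k : ℕ) :
    ∀ᵐ ω ∂P, filterLaw P X Y U (k + 1) (infoVec Y U (k + 1) ω) =
      (∫⁻ x, (M.ρ (Y (k + 1) ω) x : ℝ≥0∞) ∂(predictedLaw P X Y U k (infoVec Y U k ω)))⁻¹ •
      (predictedLaw P X Y U k (infoVec Y U k ω)).withDensity
        fun x => (M.ρ (Y (k + 1) ω) x : ℝ≥0∞) := by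
  have mI := h.measurable_infoVec
  have mX := h.measurable_X
  have mπ := h.measurable_policy k
  have mρ := M.measurable_ρ.coe_nnreal_ennreal
  let pred := predictedLaw P X Y U k
  let Z : Info ny nu k × Vec ny → ℝ≥0∞ := fun p => ∫⁻ x, (M.ρ p.2 x : ℝ≥0∞) ∂(pred p.1)
  have mZ : Measurable Z := by
    have : Measurable (Function.uncurry fun (p : Info ny nu k × Vec ny) x =>
        (M.ρ p.2 x : ℝ≥0∞)) :=
      mρ.comp (f := fun q : (Info ny nu k × Vec ny) × Vec nx => (q.1.2, q.2)) (by fun_prop)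
    exact this.lintegral_kernel_prod_right (κ := pred.comap Prod.fst measurable_fst)
  have hZtop : ∀ p, Z p ≠ ∞ := fun p => by
    refine ne_top_of_le_ne_top (b := (Bρ : ℝ≥0∞)) ENNReal.coe_ne_top ?_
    calc Z p ≤ ∫⁻ _, (Bρ : ℝ≥0∞) ∂(pred p.1) :=
          lintegral_mono fun x => ENNReal.coe_le_coe.2 (hρ p.2 x)
      _ = Bρ := by simp
  let yl : Info ny nu (k + 1) → Info ny nu k × Vec ny := fun i => (i.prev, i.last.2)
  have myl : Measurable yl :=
    Info.measurable_prev.prodMk (measurable_snd.comp Info.measurable_last)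
  -- The density with respect to the predicted law; where `Z = 0`, the likelihood vanishes almost
  -- everywhere, so that the product `ρ * Z⁻¹ = 0 * ∞` is zero there.
  let w : Info ny nu (k + 1) → Vec nx → ℝ≥0∞ := fun i x =>
    (M.ρ (yl i).2 x : ℝ≥0∞) * (Z (yl i))⁻¹
  have mw : Measurable (Function.uncurry w) :=
    (mρ.comp (f := fun q : Info ny nu (k + 1) × Vec nx => ((yl q.1).2, q.2)) (by fun_prop)).mul
      (by fun_prop)
  let κ : Kernel (Info ny nu (k + 1)) (Vec nx) :=
    Kernel.withDensity (pred.comap Info.prev Info.measurable_prev) w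
  have hκ : ∀ i, κ i = (pred i.prev).withDensity (w i) := fun i =>
    Kernel.withDensity_apply _ mw i
  have mρy : ∀ y, Measurable fun x => (M.ρ y x : ℝ≥0∞) := fun y =>
    mρ.comp (f := fun x => (y, x)) (by fun_prop)
  have hfin : IsFiniteKernel κ := ⟨⟨1, ENNReal.one_lt_top, fun i => by
    rw [hκ, withDensity_apply _ MeasurableSet.univ, setLIntegral_univ,
      lintegral_mul_const _ (mρy _)]
    exact ENNReal.mul_inv_le_one _⟩⟩
  have key : ∀ᵐ ω ∂P, filterLaw P X Y U (k + 1) (infoVec Y U (k + 1) ω) =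
      κ (infoVec Y U (k + 1) ω) := by
    refine condDistrib_ae_eq_of_lintegral (mI (k + 1)) (mX (k + 1)) κ fun g hg => ?_
    -- `I_{k+1}` as a function of `(I_k, Y_{k+1})`
    let ext : Info ny nu k × Vec ny → Info ny nu (k + 1) := fun p =>
      (Fin.snoc (α := fun _ => Vec ny) p.1.1 p.2, Fin.snoc (α := fun _ => Vec nu) p.1.2 (π k p.1))
    have mext : Measurable ext := by
      refine Measurable.prodMk (measurable_pi_lambda _ fun j => ?_)
        (measurable_pi_lambda _ fun j => ?_)
      · induction j using Fin.lastCases with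
        | last => simp only [Fin.snoc_last]; fun_prop
        | cast j => simp only [Fin.snoc_castSucc]; fun_prop
      · induction j using Fin.lastCases with
        | last => simp only [Fin.snoc_last]; fun_prop
        | cast j => simp only [Fin.snoc_castSucc]; fun_prop
    have hext : ∀ ω, infoVec Y U (k + 1) ω = ext (infoVec Y U k ω, Y (k + 1) ω) := fun ω => by
      refine Prod.ext (funext fun j => ?_) (funext fun j => ?_)
      · induction j using Fin.lastCases with
        | last => simp [infoVec, ext]
        | cast j => simp [infoVec, ext]
      · induction j using Fin.lastCases with
        | last => simpa [infoVec, ext] using h.control k ω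
        | cast j => simp [infoVec, ext]
    have hyl : ∀ p, yl (ext p) = p := fun p => by
      simp [yl, ext, Info.prev, Info.last]
    have disint : ∀ G : (Info ny nu k × Vec ny) × Vec nx → ℝ≥0∞, Measurable G →
        ∫⁻ ω, G ((infoVec Y U k ω, Y (k + 1) ω), X (k + 1) ω) ∂P =
          ∫⁻ ω, ∫⁻ y, ∫⁻ x, M.ρ y x * G ((infoVec Y U k ω, y), x)
            ∂(pred (infoVec Y U k ω)) ∂volume ∂P := by
      intro G hG
      have m1 : Measurable fun p : (Info ny nu k × Vec nx) × Vec nη =>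
          G ((p.1.1, M.h p.1.2 p.2), p.1.2) := by
        have : Measurable fun p : (Info ny nu k × Vec nx) × Vec nη => M.h p.1.2 p.2 :=
          M.measurable_h.comp (f := fun p : (Info ny nu k × Vec nx) × Vec nη => (p.1.2, p.2))
            (by fun_prop)
        fun_prop
      have m2 : Measurable fun p : (Info ny nu k × Vec nx) × Vec ny =>
          (M.ρ p.2 p.1.2 : ℝ≥0∞) * G ((p.1.1, p.2), p.1.2) :=
        (mρ.comp (f := fun p : (Info ny nu k × Vec nx) × Vec ny => (p.2, p.1.2))
          (by fun_prop)).mul (by fun_prop)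
      have m3 : Measurable fun p : Info ny nu k × Vec nx =>
          ∫⁻ y, (M.ρ y p.2 : ℝ≥0∞) * G ((p.1, y), p.2) := m2.lintegral_prod_right'
      calc ∫⁻ ω, G ((infoVec Y U k ω, Y (k + 1) ω), X (k + 1) ω) ∂P
          = ∫⁻ ω, G ((infoVec Y U k ω, M.h (X (k + 1) ω) (η (k + 1) ω)), X (k + 1) ω) ∂P := by
            simp_rw [h.observation]
        _ = ∫⁻ ω, ∫⁻ e, G ((infoVec Y U k ω, M.h (X (k + 1) ω) e), X (k + 1) ω) ∂M.pη ∂P := by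
            rw [← h.law_η (k + 1)]
            exact lintegral_comp_of_indepFun ((mI k).prodMk (mX (k + 1)))
              (h.measurable_η (k + 1)) (h.indepFun_η k) m1
        _ = ∫⁻ ω, ∫⁻ y, (M.ρ y (X (k + 1) ω) : ℝ≥0∞) *
              G ((infoVec Y U k ω, y), X (k + 1) ω) ∂volume ∂P := by
            refine lintegral_congr fun ω => ?_
            have mh : Measurable fun e => M.h (X (k + 1) ω) e :=
              M.measurable_h.comp (f := fun e => (X (k + 1) ω, e)) (by fun_prop)
            have mr : Measurable fun y => (M.ρ y (X (k + 1) ω) : ℝ≥0∞) :=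
              mρ.comp (f := fun y => (y, X (k + 1) ω)) (by fun_prop)
            rw [← lintegral_map (f := fun y => G ((infoVec Y U k ω, y), X (k + 1) ω))
              (by fun_prop) mh, M.law_h,
              lintegral_withDensity_eq_lintegral_mul _ mr (by fun_prop)]
            rfl
        _ = _ := by
            rw [lintegral_condDistrib (mI k) (mX (k + 1)) m3]
            refine lintegral_congr fun ω => ?_
            refine lintegral_lintegral_swap (Measurable.aemeasurable ?_)
            exact m2.comp (f := fun q : Vec nx × Vec ny => ((infoVec Y U k ω, q.1), q.2))
              (by fun_prop)
    have mK : Measurable fun i => ∫⁻ x, g (i, x) ∂(κ i) := hg.lintegral_kernel_prod_right'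
    simp_rw [hext]
    rw [disint (fun q => g (ext q.1, q.2)) (by fun_prop),
      disint (fun q => ∫⁻ x, g (ext q.1, x) ∂(κ (ext q.1)))
        (mK.comp (f := fun q : (Info ny nu k × Vec ny) × Vec nx => ext q.1) (by fun_prop))]
    refine lintegral_congr fun ω => lintegral_congr fun y => ?_
    set p : Info ny nu k × Vec ny := (infoVec Y U k ω, y) with hp
    have mg : Measurable fun x => g (ext p, x) := by fun_prop
    have mρg : Measurable fun x => (M.ρ y x : ℝ≥0∞) * g (ext p, x) := (mρy y).mul mg
    have hprev : (ext p).prev = p.1 := congrArg Prod.fst (hyl p)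
    have hwp : w (ext p) = fun x => (M.ρ y x : ℝ≥0∞) * (Z p)⁻¹ := by
      simp only [w, hyl]; rfl
    have e1 : ∫⁻ x, g (ext p, x) ∂(κ (ext p)) =
        (∫⁻ x, M.ρ y x * g (ext p, x) ∂(pred p.1)) * (Z p)⁻¹ := by
      rw [hκ, hprev, hwp, lintegral_withDensity_eq_lintegral_mul _ ((mρy y).mul_const _) mg,
        ← lintegral_mul_const _ mρg]
      refine lintegral_congr fun x => ?_
      simp only [Pi.mul_apply]
      ring
    change ∫⁻ x, M.ρ y x * g (ext p, x) ∂(pred p.1) =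
      ∫⁻ x, M.ρ y x * ∫⁻ x', g (ext p, x') ∂(κ (ext p)) ∂(pred p.1)
    rw [lintegral_mul_const _ (mρy y), e1]
    change _ = Z p * _
    by_cases hZ0 : Z p = 0
    · have h0 : ∀ᵐ x ∂(pred p.1), (M.ρ y x : ℝ≥0∞) = 0 := (lintegral_eq_zero_iff (mρy y)).1 hZ0
      rw [hZ0, zero_mul, lintegral_eq_zero_iff mρg]
      filter_upwards [h0] with x hx
      simp [hx]
    · rw [mul_comm, mul_assoc, ENNReal.inv_mul_cancel hZ0 (hZtop p), mul_one]
  filter_upwards [key] with ω hω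
  rw [hω, hκ, ← withDensity_smul _ (mρy _)]
  congr 1
  funext x
  simp only [w, Pi.smul_apply, smul_eq_mul]
  exact mul_comm _ _

end IsClosedLoop

/-! ### Sampling errors of empirical means -/

/-- The empirical mean `⟨μ^N, φ⟩ = (1/N) ∑ φ(x_i)` of a test function. -/
noncomputable def empMean {E : Type*} {N : ℕ} (φ : E → ℝ) (x : Fin N → E) : ℝ :=
  (N : ℝ)⁻¹ * ∑ i, φ (x i)

/-- The mean square error of `⟨μ^N, φ⟩` as an estimator of the number `v` when the particles have
the joint law `L`. -/
noncomputable def sqErr {E : Type*} [MeasurableSpace E] {N : ℕ} (L : Measure (Fin N → E))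
    (φ : E → ℝ) (v : ℝ) : ℝ≥0∞ :=
  ∫⁻ x, ENNReal.ofReal ((empMean φ x - v) ^ 2) ∂L

section Sampling

variable {E : Type*} [MeasurableSpace E] {N : ℕ}

@[fun_prop]
lemma measurable_empMean {φ : E → ℝ} (hφ : Measurable φ) :
    Measurable (empMean φ : (Fin N → E) → ℝ) := by
  unfold empMean; fun_prop

lemma memLp_two_of_sq_le {ν : Measure E} [IsFiniteMeasure ν] {φ : E → ℝ} (hφ : Measurable φ)
    {β : ℝ} (hβ : ∀ x, φ x ^ 2 ≤ β) : MemLp φ 2 ν :=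
  MemLp.of_bound hφ.aestronglyMeasurable (√β) (ae_of_all _ fun x => Real.abs_le_sqrt (hβ x))

lemma integral_sub_sq_eq {Ω : Type*} [MeasurableSpace Ω] {μ : Measure Ω} [IsProbabilityMeasure μ]
    {Z : Ω → ℝ} (hZ : MemLp Z 2 μ) (v : ℝ) :
    ∫ ω, (Z ω - v) ^ 2 ∂μ = (∫ ω, Z ω ∂μ - v) ^ 2 + Var[Z; μ] := by
  have h := variance_eq_sub (hZ.sub (memLp_const v))
  rw [show Var[Z - fun _ => v; μ] = Var[Z; μ] from variance_sub_const hZ.1 v] at h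
  simp only [Pi.sub_apply, Pi.pow_apply] at h
  rw [integral_sub (hZ.integrable one_le_two) (integrable_const v)] at h
  simp only [integral_const, probReal_univ, one_smul] at h
  linarith

/-- Bias and variance of independent sampling. -/
lemma sqErr_pi_le (hN : 0 < N) {ν : Fin N → Measure E} [∀ i, IsProbabilityMeasure (ν i)]
    {φ : E → ℝ} (hφ : ∀ i, MemLp φ 2 (ν i)) {m s v : ℝ}
    (hm : (N : ℝ)⁻¹ * ∑ i, ∫ x, φ x ∂(ν i) = m)
    (hs : (N : ℝ)⁻¹ * ∑ i, ∫ x, φ x ^ 2 ∂(ν i) ≤ s) :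
    sqErr (Measure.pi ν) φ v ≤ ENNReal.ofReal ((m - v) ^ 2) + ENNReal.ofReal s / N := by
  have hN' : (0 : ℝ) < N := by exact_mod_cast hN
  have hev : ∀ i, MemLp (fun x : Fin N → E => φ (x i)) 2 (Measure.pi ν) := fun i =>
    (hφ i).comp_measurePreserving (measurePreserving_eval ν i)
  have hsum : MemLp (fun x : Fin N → E => ∑ i, φ (x i)) 2 (Measure.pi ν) :=
    memLp_finsetSum _ fun i _ => hev i
  have hZ : MemLp (empMean φ : (Fin N → E) → ℝ) 2 (Measure.pi ν) := hsum.const_mul _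
  have hmean : ∫ x, empMean φ x ∂(Measure.pi ν) = m := by
    simp only [empMean]
    rw [integral_const_mul, integral_finsetSum _ fun i _ => (hev i).integrable one_le_two, ← hm]
    congr 1
    refine Finset.sum_congr rfl fun i _ => ?_
    exact integral_comp_eval (hφ i).1
  have hvar : Var[empMean φ; Measure.pi ν] ≤ s / N := by
    have h1 : Var[fun x : Fin N → E => ∑ i, φ (x i); Measure.pi ν] = ∑ i, Var[φ; ν i] := by
      rw [← variance_sum_pi (X := fun _ => φ) hφ]
      congr 1
      funext x
      simp
    have h2 : Var[empMean φ; Measure.pi ν] = (N : ℝ)⁻¹ ^ 2 * ∑ i, Var[φ; ν i] := by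
      rw [← h1]
      exact variance_const_mul _ _ _
    have h3 : ∑ i, Var[φ; ν i] ≤ ∑ i, ∫ x, φ x ^ 2 ∂(ν i) :=
      Finset.sum_le_sum fun i _ => variance_le_expectation_sq (hφ i).1
    calc Var[empMean φ; Measure.pi ν] = (N : ℝ)⁻¹ * ((N : ℝ)⁻¹ * ∑ i, Var[φ; ν i]) := by
          rw [h2]; ring
      _ ≤ (N : ℝ)⁻¹ * ((N : ℝ)⁻¹ * ∑ i, ∫ x, φ x ^ 2 ∂(ν i)) := by gcongr
      _ ≤ (N : ℝ)⁻¹ * s := by gcongr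
      _ = s / N := by rw [div_eq_inv_mul]
  have hint : Integrable (fun x => (empMean φ x - v) ^ 2) (Measure.pi ν) :=
    (hZ.sub (memLp_const v)).integrable_sq
  rw [sqErr, ← ofReal_integral_eq_lintegral_ofReal hint (ae_of_all _ fun x => sq_nonneg _),
    integral_sub_sq_eq hZ, hmean, ENNReal.ofReal_add (sq_nonneg _) (variance_nonneg _ _)]
  gcongr
  calc ENNReal.ofReal Var[empMean φ; Measure.pi ν] ≤ ENNReal.ofReal (s / N) :=
        ENNReal.ofReal_le_ofReal hvar
    _ = ENNReal.ofReal s / N := by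
        rw [ENNReal.ofReal_div_of_pos hN', ENNReal.ofReal_natCast]

end Sampling

namespace ControlledSystem

variable {nx nu nξ ny nη : ℕ} (M : ControlledSystem nx nu nξ ny nη) {N : ℕ}

/-- One prediction step: since the mixing matrix is doubly stochastic, the proposals are unbiased
for `⟨μ^N, Tψ⟩`, where `T` is the transition operator. -/
lemma sqErr_propose_le (hN : 0 < N) (a : doublyStochastic ℝ≥0 (Fin N)) (x : Fin N → Vec nx)
    (u : Vec nu) {ψ : Vec nx → ℝ} (hψ : Measurable ψ) {β : ℝ} (hβ : ∀ z, ψ z ^ 2 ≤ β) (v : ℝ) :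
    sqErr (M.propose a (x, u)) ψ v ≤
      ENNReal.ofReal ((empMean (fun z => ∫ z', ψ z' ∂(M.transition (z, u))) x - v) ^ 2) +
        ENNReal.ofReal β / N := by
  have hN' : (0 : ℝ) < N := by exact_mod_cast hN
  refine sqErr_pi_le hN (fun i => memLp_two_of_sq_le hψ hβ) ?_ ?_
  · have h1 : ∀ i, ∫ z, ψ z ∂(M.proposeOne a i (x, u)) =
        ∑ j, (a.1 i j : ℝ) * ∫ z, ψ z ∂(M.transition (x j, u)) := fun i => by
      change ∫ z, ψ z ∂(∑ j, a.1 i j • M.transition (x j, u)) = _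
      rw [integral_finsetSum_measure]
      · refine Finset.sum_congr rfl fun j _ => ?_
        rw [integral_smul_nnreal_measure]
        rfl
      · intro j _
        exact ((memLp_two_of_sq_le hψ hβ).integrable one_le_two).smul_measure_nnreal
    have h2 : ∀ j, ∑ i, (a.1 i j : ℝ) = 1 := fun j => by
      have h := congrFun a.2.2.2 j
      simp only [Matrix.vecMul, dotProduct, Pi.one_apply, one_mul] at h
      exact_mod_cast h
    simp only [empMean, h1]
    rw [Finset.sum_comm]
    simp_rw [← Finset.sum_mul, h2, one_mul]
  · have h1 : ∀ i, ∫ z, ψ z ^ 2 ∂(M.proposeOne a i (x, u)) ≤ β := fun i => by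
      calc ∫ z, ψ z ^ 2 ∂(M.proposeOne a i (x, u)) ≤ ∫ _, β ∂(M.proposeOne a i (x, u)) := by
            refine integral_mono (memLp_two_of_sq_le hψ hβ).integrable_sq (integrable_const _)
              hβ
        _ = β := by simp
    calc (N : ℝ)⁻¹ * ∑ i, ∫ z, ψ z ^ 2 ∂(M.proposeOne a i (x, u))
        ≤ (N : ℝ)⁻¹ * ∑ _i : Fin N, β := by gcongr with i; exact h1 i
      _ = β := by simp; field_simp

lemma sum_weight (y : Vec ny) (x : Fin N → Vec nx) (hN : 0 < N) :
    ∑ j, (M.weight y x j : ℝ) = 1 := by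
  have h : ∑ j, M.weight y x j = 1 := by
    by_cases h0 : ∑ l, M.ρ y (x l) = 0
    · simp only [weight, h0, if_true]
      simp [hN.ne']
    · simp only [weight, h0, if_false]
      rw [← Finset.sum_div, div_self h0]
  exact_mod_cast h

/-- One resampling step: the resampled particles are unbiased for the weighted mean. -/
lemma sqErr_resample_le (hN : 0 < N) (x : Fin N → Vec nx) (y : Vec ny) {φ : Vec nx → ℝ}
    (hφ : Measurable φ) (v : ℝ) :
    sqErr (M.resample (x, y)) φ v ≤
      ENNReal.ofReal ((∑ j, (M.weight y x j : ℝ) * φ (x j) - v) ^ 2) +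
        ENNReal.ofReal (∑ j, (M.weight y x j : ℝ) * φ (x j) ^ 2) / N := by
  have hN' : (N : ℝ) ≠ 0 := by exact_mod_cast hN.ne'
  have hint : ∀ i, ∀ ψ : Vec nx → ℝ, Measurable ψ → Integrable ψ (M.resampleOne i (x, y)) ∧
      ∫ z, ψ z ∂(M.resampleOne i (x, y)) = ∑ j, (M.weight y x j : ℝ) * ψ (x j) := by
    intro i ψ hψ
    change Integrable ψ (∑ j, M.weight y x j • Measure.dirac (x j)) ∧
      ∫ z, ψ z ∂(∑ j, M.weight y x j • Measure.dirac (x j)) = _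
    have hj : ∀ j ∈ (Finset.univ : Finset (Fin N)),
        Integrable ψ (M.weight y x j • Measure.dirac (x j)) := fun j _ =>
      (integrable_dirac (by simp)).smul_measure_nnreal
    refine ⟨integrable_finsetSum_measure.2 hj, ?_⟩
    rw [integral_finsetSum_measure hj]
    refine Finset.sum_congr rfl fun j _ => ?_
    rw [integral_smul_nnreal_measure, integral_dirac]
    rfl
  refine sqErr_pi_le hN (fun i => ?_) ?_ ?_
  · exact (memLp_two_iff_integrable_sq hφ.aestronglyMeasurable).2 (hint i _ (hφ.pow_const 2)).1
  · simp only [(hint _ _ hφ).2, Finset.sum_const, Finset.card_univ, Fintype.card_fin, nsmul_eq_mul]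
    field_simp
  · simp only [(hint _ _ (hφ.pow_const 2)).2, Finset.sum_const, Finset.card_univ, Fintype.card_fin,
      nsmul_eq_mul]
    exact le_of_eq (by field_simp)

end ControlledSystem

/-! ### Selection and correction -/

/-- Bound for the second moment of a test function `φ` with `ρ φ² ≤ B` and `φ(0)² ≤ d` under the
weighted particles and for the squared filtered mean of `φ`. -/
noncomputable def momentBound (γ Bρ B d : ℝ≥0) : ℝ≥0 := 2 * B / γ + Bρ * B / γ ^ 2 + d

/-- The error of a ratio of empirical means, for the weighted mean `W = Q / R`. -/
lemma sq_ratio_sub_ratio_le {Q R q r γ D : ℝ} (hγ : 0 < γ) (hR : R ≠ 0) (hr : γ ≤ r)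
    (hD : (Q / R) ^ 2 ≤ D) :
    (Q / R - q / r) ^ 2 ≤ 2 / γ ^ 2 * ((Q - q) ^ 2 + D * (R - r) ^ 2) := by
  have hr0 : 0 < r := hγ.trans_le hr
  have h1 : Q / R - q / r = ((Q - q) - Q / R * (R - r)) / r := by
    field_simp
    ring
  have h2 : ((Q - q) - Q / R * (R - r)) ^ 2 ≤ 2 * ((Q - q) ^ 2 + D * (R - r) ^ 2) := by
    have h3 : (Q / R) ^ 2 * (R - r) ^ 2 ≤ D * (R - r) ^ 2 :=
      mul_le_mul_of_nonneg_right hD (sq_nonneg _)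
    nlinarith [sq_nonneg ((Q - q) + Q / R * (R - r))]
  have h4 : 0 ≤ (Q - q) ^ 2 + D * (R - r) ^ 2 := by
    have := (sq_nonneg _).trans hD
    positivity
  rw [h1, div_pow, div_mul_eq_mul_div 2]
  exact div_le_div₀ (by positivity) h2 (by positivity) (by gcongr)

namespace ControlledSystem

variable {nx nu nξ ny nη : ℕ} (M : ControlledSystem nx nu nξ ny nη) {N : ℕ}

lemma measurableSet_acceptSet (t : ℝ≥0) (y : Vec ny) :
    MeasurableSet (M.acceptSet (N := N) t y) :=
  measurableSet_le measurable_const (M.measurable_avgLikelihood.comp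
    (f := fun x : Fin N → Vec nx => (y, x)) (by fun_prop))

/-- Selection at the cost of a factor `2` and of the rejection probability. If acceptance has
probability at least `1/2`, conditioning on it at most doubles integrals; otherwise the bound `S` is
paid for by the rejection probability, which then is at least `1/2`. -/
lemma lintegral_select_le (a : doublyStochastic ℝ≥0 (Fin N)) (t : ℝ≥0) (x : Fin N → Vec nx)
    (u : Vec nu) (y : Vec ny) {g h : (Fin N → Vec nx) → ℝ≥0∞} (hg : Measurable g) {S : ℝ≥0∞}
    (hgh : ∀ z ∈ M.acceptSet t y, g z ≤ h z) (hgS : ∀ z ∈ M.acceptSet t y, g z ≤ S)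
    (hg0 : g 0 ≤ S) :
    ∫⁻ z, g z ∂(M.select a t (x, u, y)) ≤
      2 * ∫⁻ z, h z ∂(M.propose a (x, u)) + 2 * S * M.propose a (x, u) (M.acceptSet t y)ᶜ := by
  classical
  have hA := M.measurableSet_acceptSet (N := N) t y
  set A := M.acceptSet (N := N) t y
  set ν := M.propose a (x, u)
  have hsel : M.select a t (x, u, y) = if ν A = 0 then Measure.dirac 0 else ν[|A] := rfl
  have hcompl : ν Aᶜ = 1 - ν A := prob_compl_eq_one_sub hA
  have hle : ν A ≤ 1 := prob_le_one
  rw [hsel]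
  by_cases hp : 2⁻¹ ≤ ν A
  · have hp0 : ν A ≠ 0 := fun h0 => by simp [h0] at hp
    rw [if_neg hp0, ProbabilityTheory.cond, lintegral_smul_measure, smul_eq_mul]
    refine le_add_of_le_of_nonneg ?_ zero_le
    refine mul_le_mul' ?_ ?_
    · simpa using ENNReal.inv_le_inv.2 hp
    · exact (setLIntegral_mono' hA hgh).trans (setLIntegral_le_lintegral _ _)
  · have hS : S ≤ 2 * S * ν Aᶜ := by
      have h1 : (2 : ℝ≥0∞)⁻¹ ≤ ν Aᶜ := by
        rw [hcompl]
        calc (2 : ℝ≥0∞)⁻¹ = 1 - 2⁻¹ := ENNReal.one_sub_inv_two.symm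
          _ ≤ 1 - ν A := tsub_le_tsub_left (not_le.1 hp).le _
      calc S = 2 * S * 2⁻¹ := by
            rw [mul_comm 2 S, mul_assoc, ENNReal.mul_inv_cancel two_ne_zero ENNReal.ofNat_ne_top,
              mul_one]
        _ ≤ 2 * S * ν Aᶜ := by gcongr
    refine le_add_of_nonneg_of_le zero_le (le_trans ?_ hS)
    split_ifs with h0
    · rwa [lintegral_dirac' _ hg]
    · rw [ProbabilityTheory.cond, lintegral_smul_measure, smul_eq_mul]
      calc (ν A)⁻¹ * ∫⁻ z in A, g z ∂ν ≤ (ν A)⁻¹ * ∫⁻ _ in A, S ∂ν :=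
            mul_le_mul' le_rfl (setLIntegral_mono' hA hgS)
        _ = S := by
            rw [setLIntegral_const, mul_comm S, ← mul_assoc,
              ENNReal.inv_mul_cancel h0 (ne_top_of_le_ne_top ENNReal.one_ne_top hle), one_mul]

lemma coe_avgLikelihood (y : Vec ny) (x : Fin N → Vec nx) :
    (M.avgLikelihood y x : ℝ) = empMean (fun z => (M.ρ y z : ℝ)) x := by
  simp [avgLikelihood, empMean, div_eq_inv_mul]

/-- For accepted proposals, weighted means are ratios of empirical means. -/
lemma sum_weight_mul (hN : 0 < N) (y : Vec ny) (x : Fin N → Vec nx)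
    (hx : empMean (fun z => (M.ρ y z : ℝ)) x ≠ 0) (ψ : Vec nx → ℝ) :
    ∑ j, (M.weight y x j : ℝ) * ψ (x j) =
      empMean (fun z => M.ρ y z * ψ z) x / empMean (fun z => (M.ρ y z : ℝ)) x := by
  have hN' : (N : ℝ) ≠ 0 := by exact_mod_cast hN.ne'
  have h0 : ∑ l, M.ρ y (x l) ≠ 0 := fun h => hx (by
    have : ∑ l, (M.ρ y (x l) : ℝ) = 0 := by exact_mod_cast h
    simp [empMean, this])
  have hw : ∀ j, (M.weight y x j : ℝ) = M.ρ y (x j) / ∑ l, (M.ρ y (x l) : ℝ) := fun j => by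
    simp [weight, h0]
  simp only [hw, empMean]
  rw [mul_div_mul_left _ _ (inv_ne_zero hN'), Finset.sum_div]
  exact Finset.sum_congr rfl fun j _ => by ring

lemma sq_sum_weight_le (hN : 0 < N) (y : Vec ny) (x : Fin N → Vec nx) (ψ : Vec nx → ℝ) :
    (∑ j, (M.weight y x j : ℝ) * ψ (x j)) ^ 2 ≤ ∑ j, (M.weight y x j : ℝ) * ψ (x j) ^ 2 :=
  (even_two.convexOn_pow (𝕜 := ℝ)).map_sum_le (fun _ _ => NNReal.coe_nonneg _)
    (M.sum_weight y x hN) fun _ _ => Set.mem_univ _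

lemma sum_weight_sq_le (hN : 0 < N) {γ Bρ B d : ℝ≥0} (hγ : 0 < γ) (y : Vec ny)
    {φ : Vec nx → ℝ} (hB : ∀ z, M.ρ y z * φ z ^ 2 ≤ B) {x : Fin N → Vec nx}
    (hx : x ∈ M.acceptSet (γ / 2) y) :
    ∑ j, (M.weight y x j : ℝ) * φ (x j) ^ 2 ≤ momentBound γ Bρ B d := by
  have hN' : (N : ℝ) ≠ 0 := by exact_mod_cast hN.ne'
  have hγ' : (0 : ℝ) < γ := by exact_mod_cast hγ
  have hR : (γ / 2 : ℝ) ≤ empMean (fun z => (M.ρ y z : ℝ)) x := by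
    rw [← coe_avgLikelihood]
    exact_mod_cast hx
  have hR0 : 0 < empMean (fun z => (M.ρ y z : ℝ)) x := by linarith
  rw [M.sum_weight_mul hN y x hR0.ne' fun z => φ z ^ 2]
  have h1 : empMean (fun z => M.ρ y z * φ z ^ 2) x ≤ B := by
    calc empMean (fun z => M.ρ y z * φ z ^ 2) x ≤ (N : ℝ)⁻¹ * ∑ _i : Fin N, (B : ℝ) := by
          unfold empMean
          gcongr with i
          exact hB _
      _ = B := by simp; field_simp
  calc empMean (fun z => M.ρ y z * φ z ^ 2) x / empMean (fun z => (M.ρ y z : ℝ)) x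
      ≤ B / (γ / 2) := by gcongr
    _ = 2 * B / γ := by field_simp
    _ ≤ 2 * B / γ + Bρ * B / γ ^ 2 + d := by
        have : (0 : ℝ) ≤ Bρ * B / γ ^ 2 + d := by positivity
        linarith
    _ = momentBound γ Bρ B d := by simp [momentBound]

/-- The error of selection, correction and resampling, in terms of the errors of the first proposals
as estimators of the predicted means of `ρφ` and `ρ`. -/
lemma lintegral_sqErr_resample_select_le (hN : 0 < N) (a : doublyStochastic ℝ≥0 (Fin N))
    {γ Bρ B d : ℝ≥0} (hγ : 0 < γ) (x : Fin N → Vec nx) (u : Vec nu) (y : Vec ny)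
    {φ : Vec nx → ℝ} (hφ : Measurable φ) (hB : ∀ z, M.ρ y z * φ z ^ 2 ≤ B) (hd : φ 0 ^ 2 ≤ d)
    {q r : ℝ} (hr : γ ≤ r) (hq : q ^ 2 ≤ Bρ * B) :
    ∫⁻ z, sqErr (M.resample (z, y)) φ (q / r) ∂(M.select a (γ / 2) (x, u, y)) ≤
      2 * (momentBound γ Bρ B d / N + (2 / γ ^ 2 : ℝ≥0) *
        (sqErr (M.propose a (x, u)) (fun z => M.ρ y z * φ z) q +
          momentBound γ Bρ B d * sqErr (M.propose a (x, u)) (fun z => (M.ρ y z : ℝ)) r)) +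
      2 * (5 * momentBound γ Bρ B d : ℝ≥0) *
        ((4 / γ ^ 2 : ℝ≥0) * sqErr (M.propose a (x, u)) (fun z => (M.ρ y z : ℝ)) r) := by
  have hN1 : (1 : ℝ≥0∞) ≤ N := by exact_mod_cast hN
  have hγ' : (0 : ℝ) < γ := by exact_mod_cast hγ
  have mρ : Measurable fun z => (M.ρ y z : ℝ) :=
    (M.measurable_ρ.comp (f := fun z => (y, z)) (by fun_prop)).coe_nnreal_real
  set D := momentBound γ Bρ B d with hD
  have hDv : (q / r) ^ 2 ≤ D := by
    have hr0 : 0 < r := hγ'.trans_le hr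
    calc (q / r) ^ 2 = q ^ 2 / r ^ 2 := div_pow _ _ _
      _ ≤ Bρ * B / γ ^ 2 := by gcongr
      _ ≤ 2 * B / γ + Bρ * B / γ ^ 2 + d := by
          have : (0 : ℝ) ≤ 2 * B / γ + d := by positivity
          linarith
      _ = D := by simp [hD, momentBound]
  have hdD : φ 0 ^ 2 ≤ D := by
    refine hd.trans ?_
    have : d ≤ D := le_add_of_nonneg_left (by positivity)
    exact_mod_cast this
  -- a crude bound, wherever the weighted second moment is controlled
  have crude : ∀ z : Fin N → Vec nx, ∑ j, (M.weight y z j : ℝ) * φ (z j) ^ 2 ≤ D →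
      sqErr (M.resample (z, y)) φ (q / r) ≤ (5 * D : ℝ≥0) := fun z hz => by
    have h1 : (∑ j, (M.weight y z j : ℝ) * φ (z j) - q / r) ^ 2 ≤ 4 * D := by
      have h2 := (M.sq_sum_weight_le hN y z φ).trans hz
      nlinarith [sq_nonneg (∑ j, (M.weight y z j : ℝ) * φ (z j) + q / r)]
    calc sqErr (M.resample (z, y)) φ (q / r)
        ≤ ENNReal.ofReal (4 * D) + ENNReal.ofReal D / N :=
          (M.sqErr_resample_le hN z y hφ _).trans (by gcongr)
      _ ≤ ENNReal.ofReal (4 * D) + ENNReal.ofReal D / 1 := by gcongr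
      _ = (5 * D : ℝ≥0) := by
          rw [div_one, ← ENNReal.ofReal_add (by positivity) (by positivity),
            ← ENNReal.ofReal_coe_nnreal]
          congr 1
          push_cast
          ring
  have mres : Measurable fun z : Fin N → Vec nx => sqErr (M.resample (z, y)) φ (q / r) := by
    have : Measurable fun w : Fin N → Vec nx => ENNReal.ofReal ((empMean φ w - q / r) ^ 2) := by
      fun_prop
    exact (this.lintegral_kernel (κ := M.resample (N := N))).comp
      (f := fun z : Fin N → Vec nx => (z, y)) (by fun_prop)
  have hsel := M.lintegral_select_le a (γ / 2) x u y (S := (5 * D : ℝ≥0))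
    (g := fun z => sqErr (M.resample (z, y)) φ (q / r))
    (h := fun z => D / N + (2 / γ ^ 2 : ℝ≥0) *
      (ENNReal.ofReal ((empMean (fun z => M.ρ y z * φ z) z - q) ^ 2) +
        D * ENNReal.ofReal ((empMean (fun z => (M.ρ y z : ℝ)) z - r) ^ 2))) mres
    (fun z hz => ?_) (fun z hz => crude z (M.sum_weight_sq_le hN hγ y hB hz)) (crude 0 ?_)
  · refine hsel.trans (add_le_add (mul_le_mul' le_rfl (le_of_eq ?_)) (mul_le_mul' le_rfl ?_))
    · rw [lintegral_add_left measurable_const, lintegral_const, measure_univ, mul_one,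
        lintegral_const_mul, lintegral_add_left, lintegral_const_mul]
      · simp [sqErr]
      all_goals fun_prop
    -- Chebyshev's inequality for the mean likelihood, whose predicted value is at least `γ`
    · have hsub : (M.acceptSet (N := N) (γ / 2) y)ᶜ ⊆ {z | ENNReal.ofReal ((γ / 2) ^ 2) ≤
          ENNReal.ofReal ((empMean (fun z => (M.ρ y z : ℝ)) z - r) ^ 2)} := fun z hz => by
        refine ENNReal.ofReal_le_ofReal ?_
        have h1 : M.avgLikelihood y z < γ / 2 := not_le.1 hz
        have h2 : (M.avgLikelihood y z : ℝ) < γ / 2 := by exact_mod_cast h1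
        rw [coe_avgLikelihood] at h2
        nlinarith
      refine (measure_mono hsub).trans ((meas_ge_le_lintegral_div (by fun_prop)
        (ENNReal.ofReal_pos.2 (by positivity)).ne' ENNReal.ofReal_ne_top).trans (le_of_eq ?_))
      rw [div_eq_mul_inv, mul_comm, ← ENNReal.ofReal_inv_of_pos (by positivity),
        ← ENNReal.ofReal_coe_nnreal]
      congr 2
      push_cast
      field_simp
      norm_num
  · have hR : (γ / 2 : ℝ) ≤ empMean (fun z => (M.ρ y z : ℝ)) z := by
      rw [← coe_avgLikelihood]
      exact_mod_cast hz
    have hR0 : empMean (fun z => (M.ρ y z : ℝ)) z ≠ 0 := by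
      have : (0 : ℝ) < γ / 2 := by positivity
      exact (this.trans_le hR).ne'
    have hw := M.sum_weight_sq_le (Bρ := Bρ) (d := d) hN hγ y hB hz
    have hW := (M.sq_sum_weight_le hN y z φ).trans hw
    have hres := M.sqErr_resample_le hN z y hφ (q / r)
    rw [M.sum_weight_mul hN y z hR0] at hW hres
    refine hres.trans ?_
    rw [add_comm]
    refine add_le_add ?_ ?_
    · gcongr
      rw [← ENNReal.ofReal_coe_nnreal]
      exact ENNReal.ofReal_le_ofReal hw
    · refine (ENNReal.ofReal_le_ofReal (sq_ratio_sub_ratio_le (q := q) hγ' hR0 hr hW)).trans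
        (le_of_eq ?_)
      rw [ENNReal.ofReal_mul (by positivity), ENNReal.ofReal_add (by positivity) (by positivity),
        ENNReal.ofReal_mul (by positivity), ENNReal.ofReal_coe_nnreal,
        ← ENNReal.ofReal_coe_nnreal (p := 2 / γ ^ 2)]
      push_cast
      rfl
  · simp only [Pi.zero_apply, ← Finset.sum_mul]
    rwa [M.sum_weight y 0 hN, one_mul]

end ControlledSystem

/-! ### Propagation of the error through one step of the filter -/

lemma sq_integral_le {E : Type*} [MeasurableSpace E] {ν : Measure E} [IsProbabilityMeasure ν]
    {φ : E → ℝ} {β : ℝ} (hβ0 : 0 ≤ β) (hβ : ∀ x, φ x ^ 2 ≤ β) : (∫ x, φ x ∂ν) ^ 2 ≤ β := by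
  have h := norm_integral_le_of_norm_le_const (μ := ν) (f := φ) (C := √β)
    (ae_of_all _ fun x => Real.abs_le_sqrt (hβ x))
  simp only [probReal_univ, mul_one, Real.norm_eq_abs] at h
  calc (∫ x, φ x ∂ν) ^ 2 = |∫ x, φ x ∂ν| ^ 2 := (sq_abs _).symm
    _ ≤ √β ^ 2 := by gcongr
    _ = β := Real.sq_sqrt hβ0

/-- The empirical measures of particles with joint law `L` estimate `μ` with mean square error at
most `c β / N`, for all test functions with `φ² ≤ β`. -/
def HasMeanSquareError {E : Type*} [MeasurableSpace E] {N : ℕ} (L : Measure (Fin N → E))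
    (μ : Measure E) (c : ℝ≥0) : Prop :=
  ∀ (φ : E → ℝ) (β : ℝ≥0), Measurable φ → (∀ x, φ x ^ 2 ≤ β) →
    sqErr L φ (∫ x, φ x ∂μ) ≤ (c * β : ℝ≥0) / N

/-- The error constant after one step, for a test function `φ` with `ρ φ² ≤ B` and `φ(0)² ≤ d`, when
the constant for bounded test functions before the step is `c`. -/
noncomputable def stepConst (γ Bρ c B d : ℝ≥0) : ℝ≥0 :=
  2 * (momentBound γ Bρ B d + 2 / γ ^ 2 *
    ((1 + c) * (Bρ * B) + momentBound γ Bρ B d * ((1 + c) * Bρ ^ 2))) +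
  2 * (5 * momentBound γ Bρ B d) * (4 / γ ^ 2 * ((1 + c) * Bρ ^ 2))

lemma stepConst_mul (γ Bρ c β : ℝ≥0) :
    stepConst γ Bρ c (Bρ * β) β = stepConst γ Bρ c Bρ 1 * β := by
  have h : momentBound γ Bρ (Bρ * β) β = momentBound γ Bρ Bρ 1 * β := by
    simp only [momentBound, div_eq_mul_inv]
    ring
  rw [stepConst, h, stepConst]
  ring

namespace ControlledSystem

variable {nx nu nξ ny nη : ℕ} (M : ControlledSystem nx nu nξ ny nη) {N : ℕ}

instance (μ : Measure (Vec nx)) [IsProbabilityMeasure μ] (u : Vec nu) :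
    IsProbabilityMeasure (μ.bind fun x => M.transition (x, u)) :=
  isProbabilityMeasure_bind (M.transition.measurable.comp (by fun_prop)).aemeasurable
    (ae_of_all _ fun _ => inferInstance)

lemma integral_bind_transition (μ : Measure (Vec nx)) [IsProbabilityMeasure μ] (u : Vec nu)
    {ψ : Vec nx → ℝ} (hψ : Measurable ψ) {β : ℝ} (hβ : ∀ z, ψ z ^ 2 ≤ β) :
    ∫ z, ψ z ∂(μ.bind fun x => M.transition (x, u)) =
      ∫ x, ∫ z, ψ z ∂(M.transition (x, u)) ∂μ := by
  have hu : Measurable fun x : Vec nx => (x, u) := by fun_prop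
  exact Kernel.integral_comp (κ := Kernel.const Unit μ) (η := M.transition.comap _ hu) (a := ())
    ((memLp_two_of_sq_le (ν := μ.bind fun x => M.transition (x, u)) hψ hβ).integrable one_le_two)

lemma lintegral_sqErr_propose_le (hN : 0 < N) (a : doublyStochastic ℝ≥0 (Fin N)) (u : Vec nu)
    {L : Measure (Fin N → Vec nx)} [IsProbabilityMeasure L] {μ : Measure (Vec nx)}
    [IsProbabilityMeasure μ] {c : ℝ≥0} (hL : HasMeanSquareError L μ c) {ψ : Vec nx → ℝ}
    (hψ : Measurable ψ) {β : ℝ≥0} (hβ : ∀ z, ψ z ^ 2 ≤ β) :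
    ∫⁻ x, sqErr (M.propose a (x, u)) ψ (∫ z, ψ z ∂(μ.bind fun x => M.transition (x, u))) ∂L ≤
      ((1 + c) * β : ℝ≥0) / N := by
  have hT : Measurable fun x => ∫ z, ψ z ∂(M.transition (x, u)) :=
    (hψ.stronglyMeasurable.integral_kernel (κ := M.transition)).measurable.comp
      (f := fun x : Vec nx => (x, u)) (by fun_prop)
  rw [M.integral_bind_transition μ u hψ hβ]
  calc ∫⁻ x, sqErr (M.propose a (x, u)) ψ (∫ x, ∫ z, ψ z ∂(M.transition (x, u)) ∂μ) ∂L
      ≤ ∫⁻ x, (ENNReal.ofReal ((empMean (fun z => ∫ z', ψ z' ∂(M.transition (z, u))) x -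
          ∫ x, ∫ z, ψ z ∂(M.transition (x, u)) ∂μ) ^ 2) + ENNReal.ofReal β / N) ∂L :=
        lintegral_mono fun x => M.sqErr_propose_le hN a x u hψ hβ _
    _ = sqErr L (fun z => ∫ z', ψ z' ∂(M.transition (z, u)))
          (∫ x, ∫ z, ψ z ∂(M.transition (x, u)) ∂μ) + β / N := by
        rw [lintegral_add_right _ measurable_const, lintegral_const, measure_univ, mul_one,
          ENNReal.ofReal_coe_nnreal]
        rfl
    _ ≤ (c * β : ℝ≥0) / N + β / N := by
        gcongr
        exact hL _ β hT fun x => sq_integral_le (by positivity) hβ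
    _ = ((1 + c) * β : ℝ≥0) / N := by
        rw [← ENNReal.add_div]
        congr 1
        push_cast
        ring

/-- One full step of the particle filter, compared with one step of the exact filter. -/
lemma lintegral_sqErr_step_le (hN : 0 < N) (a : doublyStochastic ℝ≥0 (Fin N)) (u : Vec nu)
    (y : Vec ny) {L : Measure (Fin N → Vec nx)} [IsProbabilityMeasure L] {μ : Measure (Vec nx)}
    [IsProbabilityMeasure μ] {c γ Bρ B d : ℝ≥0} (hL : HasMeanSquareError L μ c) (hγ : 0 < γ)
    (hρ : ∀ y x, M.ρ y x ≤ Bρ)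
    (hZ : (γ : ℝ≥0∞) ≤ ∫⁻ x, (M.ρ y x : ℝ≥0∞) ∂(μ.bind fun x => M.transition (x, u)))
    {φ : Vec nx → ℝ} (hφ : Measurable φ) (hB : ∀ z, M.ρ y z * φ z ^ 2 ≤ B) (hd : φ 0 ^ 2 ≤ d) :
    ∫⁻ x, ∫⁻ z, sqErr (M.resample (z, y)) φ
      (∫ x, φ x ∂((∫⁻ x, (M.ρ y x : ℝ≥0∞) ∂(μ.bind fun x => M.transition (x, u)))⁻¹ •
        (μ.bind fun x => M.transition (x, u)).withDensity fun x => (M.ρ y x : ℝ≥0∞)))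
      ∂(M.select a (γ / 2) (x, u, y)) ∂L ≤ (stepConst γ Bρ c B d : ℝ≥0∞) / N := by
  set ν := μ.bind fun x => M.transition (x, u) with hν
  have mρ0 : Measurable fun z => M.ρ y z :=
    M.measurable_ρ.comp (f := fun z => (y, z)) (by fun_prop)
  have mρ : Measurable fun z => (M.ρ y z : ℝ) := mρ0.coe_nnreal_real
  have hρ' : ∀ z, (M.ρ y z : ℝ) ≤ Bρ := fun z => by exact_mod_cast hρ y z
  have hρ2 : ∀ z, (M.ρ y z : ℝ) ^ 2 ≤ (Bρ ^ 2 : ℝ≥0) := fun z => by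
    push_cast
    exact pow_le_pow_left₀ (NNReal.coe_nonneg _) (hρ' z) 2
  have hρφ2 : ∀ z, (M.ρ y z * φ z) ^ 2 ≤ (Bρ * B : ℝ≥0) := fun z => by
    push_cast
    calc ((M.ρ y z : ℝ) * φ z) ^ 2 = M.ρ y z * (M.ρ y z * φ z ^ 2) := by ring
      _ ≤ (Bρ : ℝ) * B := mul_le_mul (hρ' z) (hB z) (by positivity) (by positivity)
  set q := ∫ x, (M.ρ y x : ℝ) * φ x ∂ν with hq
  set r := ∫ x, (M.ρ y x : ℝ) ∂ν with hr
  have hρint : Integrable (fun x => (M.ρ y x : ℝ)) ν :=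
    (memLp_two_of_sq_le mρ hρ2).integrable one_le_two
  have hZr : ∫⁻ x, (M.ρ y x : ℝ≥0∞) ∂ν = ENNReal.ofReal r := lintegral_coe_eq_integral _ hρint
  have hr0 : 0 ≤ r := integral_nonneg fun x => NNReal.coe_nonneg _
  have hγr : (γ : ℝ) ≤ r := by
    rw [hZr, ← ENNReal.ofReal_coe_nnreal] at hZ
    exact (ENNReal.ofReal_le_ofReal_iff hr0).1 hZ
  have hv : ∫ x, φ x ∂((∫⁻ x, (M.ρ y x : ℝ≥0∞) ∂ν)⁻¹ •
      ν.withDensity fun x => (M.ρ y x : ℝ≥0∞)) = q / r := by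
    rw [integral_smul_measure, integral_withDensity_eq_integral_smul mρ0, hZr,
      ENNReal.toReal_inv, ENNReal.toReal_ofReal hr0, smul_eq_mul, div_eq_inv_mul]
    rfl
  have e1 := M.lintegral_sqErr_propose_le hN a u hL (mρ.mul hφ) hρφ2
  have e2 := M.lintegral_sqErr_propose_le hN a u hL mρ hρ2
  rw [← hν] at e1 e2
  change ∫⁻ x, sqErr _ (fun z => M.ρ y z * φ z) q ∂L ≤ _ at e1
  rw [← hr] at e2
  rw [hv]
  have mS : ∀ ψ : Vec nx → ℝ, Measurable ψ → ∀ v : ℝ,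
      Measurable fun x => sqErr (M.propose a (x, u)) ψ v := fun ψ hψ v => by
    have : Measurable fun w : Fin N → Vec nx => ENNReal.ofReal ((empMean ψ w - v) ^ 2) := by
      fun_prop
    exact (this.lintegral_kernel (κ := M.propose a)).comp
      (f := fun x : Fin N → Vec nx => (x, u)) (by fun_prop)
  have m1 := mS _ (mρ.mul hφ) q
  have m2 := mS _ mρ r
  refine (lintegral_mono fun x => M.lintegral_sqErr_resample_select_le hN a hγ x u y hφ hB hd hγr
    (Bρ := Bρ) ?_).trans ?_
  · exact_mod_cast sq_integral_le (by positivity) hρφ2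
  set D := momentBound γ Bρ B d with hD
  set G := 2 / γ ^ 2 with hG
  set H := 4 / γ ^ 2 with hH
  calc ∫⁻ x, (2 * (D / N + G * (sqErr (M.propose a (x, u)) (fun z => M.ρ y z * φ z) q +
          D * sqErr (M.propose a (x, u)) (fun z => (M.ρ y z : ℝ)) r)) +
        2 * (5 * D : ℝ≥0) * (H * sqErr (M.propose a (x, u)) (fun z => (M.ρ y z : ℝ)) r)) ∂L
      = 2 * (D / N + G * (∫⁻ x, sqErr (M.propose a (x, u)) (fun z => M.ρ y z * φ z) q ∂L +
          D * ∫⁻ x, sqErr (M.propose a (x, u)) (fun z => (M.ρ y z : ℝ)) r ∂L)) +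
        2 * (5 * D : ℝ≥0) *
          (H * ∫⁻ x, sqErr (M.propose a (x, u)) (fun z => (M.ρ y z : ℝ)) r ∂L) := by
        have m3 : Measurable fun x => sqErr (M.propose a (x, u)) (fun z => M.ρ y z * φ z) q := m1
        rw [lintegral_add_left (by fun_prop), lintegral_const_mul _ (by fun_prop),
          lintegral_add_left (by fun_prop), lintegral_const, measure_univ, mul_one,
          lintegral_const_mul _ (by fun_prop), lintegral_add_left m3,
          lintegral_const_mul _ m2, lintegral_const_mul _ (by fun_prop), lintegral_const_mul _ m2]
    _ ≤ 2 * (D / N + G * (((1 + c) * (Bρ * B) : ℝ≥0) / N +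
          D * (((1 + c) * Bρ ^ 2 : ℝ≥0) / N))) +
        2 * (5 * D : ℝ≥0) * (H * (((1 + c) * Bρ ^ 2 : ℝ≥0) / N)) := by
        gcongr
    _ = (stepConst γ Bρ c B d : ℝ≥0∞) / N := by
        rw [stepConst, ← hD, ← hG, ← hH]
        simp only [div_eq_mul_inv]
        push_cast
        ring

end ControlledSystem

/-! ### Error bounds along a trajectory -/

/-- The constants of the error bound for bounded test functions. -/
noncomputable def errConst (γ : ℕ → ℝ≥0) (Bρ : ℝ≥0) : ℕ → ℝ≥0
  | 0 => 1
  | k + 1 => stepConst (γ (k + 1)) Bρ (errConst γ Bρ k) Bρ 1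

/-- Along the information vectors `i_k`, the probability measures `m_k` satisfy the filtering
recursion (prediction, then Bayes' formula), with normalising constants at least `γ_k`. -/
structure IsFilterRecursion {nx nu nξ ny nη : ℕ} (M : ControlledSystem nx nu nξ ny nη)
    (γ : ℕ → ℝ≥0) (i : (k : ℕ) → Info ny nu k) (m : ℕ → Measure (Vec nx)) : Prop where
  prob : ∀ k, IsProbabilityMeasure (m k)
  prev : ∀ k, (i (k + 1)).prev = i k
  le : ∀ k, (γ (k + 1) : ℝ≥0∞) ≤ ∫⁻ x, (M.ρ (i (k + 1)).last.2 x : ℝ≥0∞)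
    ∂((m k).bind fun x => M.transition (x, (i (k + 1)).last.1))
  bayes : ∀ k, m (k + 1) = (∫⁻ x, (M.ρ (i (k + 1)).last.2 x : ℝ≥0∞)
      ∂((m k).bind fun x => M.transition (x, (i (k + 1)).last.1)))⁻¹ •
    ((m k).bind fun x => M.transition (x, (i (k + 1)).last.1)).withDensity
      fun x => (M.ρ (i (k + 1)).last.2 x : ℝ≥0∞)

namespace IsFilterRecursion

variable {nx nu nξ ny nη : ℕ} {M : ControlledSystem nx nu nξ ny nη} {γ : ℕ → ℝ≥0}
  {i : (k : ℕ) → Info ny nu k} {m : ℕ → Measure (Vec nx)} {N : ℕ}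

lemma sqErr_succ_le (h : IsFilterRecursion M γ i m) (hN : 0 < N) {Bρ c B d : ℝ≥0}
    (hρ : ∀ y x, M.ρ y x ≤ Bρ) {μ₀ : Kernel (Info ny nu 0) (Vec nx)} [IsMarkovKernel μ₀]
    (a : ℕ → doublyStochastic ℝ≥0 (Fin N)) (k : ℕ) (hγ : 0 < γ (k + 1))
    (hk : HasMeanSquareError (M.particleLaw μ₀ a (fun l => γ l / 2) k (i k)) (m k) c)
    {φ : Vec nx → ℝ} (hφ : Measurable φ) (hB : ∀ y z, M.ρ y z * φ z ^ 2 ≤ B) (hd : φ 0 ^ 2 ≤ d) :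
    sqErr (M.particleLaw μ₀ a (fun l => γ l / 2) (k + 1) (i (k + 1))) φ (∫ x, φ x ∂(m (k + 1))) ≤
      (stepConst (γ (k + 1)) Bρ c B d : ℝ≥0∞) / N := by
  have := h.prob k
  rw [h.bayes k]
  refine le_trans (le_of_eq ?_) (M.lintegral_sqErr_step_le hN (a (k + 1)) (i (k + 1)).last.1
    (i (k + 1)).last.2 hk hγ hρ (h.le k) hφ (hB _) hd)
  have mg : ∀ v : ℝ, Measurable fun w : Fin N → Vec nx =>
      ENNReal.ofReal ((empMean φ w - v) ^ 2) := fun v => by fun_prop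
  have m1 : ∀ v : ℝ, Measurable fun p : (Fin N → Vec nx) × Vec ny =>
      ∫⁻ w, ENNReal.ofReal ((empMean φ w - v) ^ 2) ∂(M.resample p) := fun v =>
    (mg v).lintegral_kernel
  have m2 : ∀ v : ℝ, Measurable fun p : (Fin N → Vec nx) × Vec nu × Vec ny =>
      ∫⁻ w, ENNReal.ofReal ((empMean φ w - v) ^ 2)
        ∂(M.filterStep (a (k + 1)) (γ (k + 1) / 2) p) := fun v => (mg v).lintegral_kernel
  rw [sqErr, ControlledSystem.particleLaw, Kernel.lintegral_comp _ _ _ (mg _),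
    Kernel.lintegral_prod_deterministic _ _ _ (m2 _), Kernel.comap_apply, h.prev k]
  refine lintegral_congr fun x => ?_
  rw [ControlledSystem.filterStep, Kernel.lintegral_comp _ _ _ (mg _),
    Kernel.lintegral_prod_deterministic _ _ _ (m1 _)]
  rfl

/-- At time `0`, the particles are a sample from `μ_0`. -/
lemma sqErr_zero_le (h : IsFilterRecursion M γ i m) (hN : 0 < N)
    {μ₀ : Kernel (Info ny nu 0) (Vec nx)} [IsMarkovKernel μ₀] (h0 : m 0 = μ₀ (i 0))
    (a : ℕ → doublyStochastic ℝ≥0 (Fin N)) (t : ℕ → ℝ≥0) {φ : Vec nx → ℝ}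
    (hφ : MemLp φ 2 (m 0)) :
    sqErr (M.particleLaw μ₀ a t 0 (i 0)) φ (∫ x, φ x ∂(m 0)) ≤
      ENNReal.ofReal (∫ x, φ x ^ 2 ∂(m 0)) / N := by
  have hN' : (N : ℝ) ≠ 0 := by exact_mod_cast hN.ne'
  have := h.prob 0
  have h1 : M.particleLaw μ₀ a t 0 (i 0) = Measure.pi fun _ => m 0 := by rw [h0]; rfl
  rw [h1]
  refine (sqErr_pi_le hN (fun _ => hφ) (m := ∫ x, φ x ∂(m 0)) (s := ∫ x, φ x ^ 2 ∂(m 0))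
    ?_ (le_of_eq ?_)).trans (by simp)
  all_goals simp only [Finset.sum_const, Finset.card_univ, Fintype.card_fin, nsmul_eq_mul]
  all_goals field_simp

lemma hasMeanSquareError (h : IsFilterRecursion M γ i m) (hN : 0 < N) {Bρ : ℝ≥0}
    (hρ : ∀ y x, M.ρ y x ≤ Bρ) (hγ : ∀ k, 0 < γ (k + 1)) {μ₀ : Kernel (Info ny nu 0) (Vec nx)}
    [IsMarkovKernel μ₀] (h0 : m 0 = μ₀ (i 0)) (a : ℕ → doublyStochastic ℝ≥0 (Fin N)) (k : ℕ) :
    HasMeanSquareError (M.particleLaw μ₀ a (fun l => γ l / 2) k (i k)) (m k)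
      (errConst γ Bρ k) := by
  induction k with
  | zero =>
    intro φ β hφ hβ
    have := h.prob 0
    refine (h.sqErr_zero_le hN h0 a _ (memLp_two_of_sq_le hφ hβ)).trans ?_
    gcongr
    rw [errConst, one_mul, ← ENNReal.ofReal_coe_nnreal]
    refine ENNReal.ofReal_le_ofReal ?_
    calc ∫ x, φ x ^ 2 ∂(m 0) ≤ ∫ _, (β : ℝ) ∂(m 0) :=
          integral_mono (memLp_two_of_sq_le hφ hβ).integrable_sq (integrable_const _) hβ
      _ = β := by simp
  | succ k ih =>
    intro φ β hφ hβ
    have h1 := h.sqErr_succ_le hN hρ a k (hγ k) ih hφ (B := Bρ * β) (d := β)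
      (fun y z => by
        push_cast
        exact mul_le_mul (by exact_mod_cast hρ y z) (hβ z) (sq_nonneg _) (by positivity)) (hβ 0)
    rwa [stepConst_mul] at h1

end IsFilterRecursion

/-! ### Mean square errors of state estimates -/

/-- Bias and variance of a constant estimate, for a law with finite second moment. -/
lemma lintegral_enorm_sub_sq {n : ℕ} {ν : Measure (Vec n)} [IsProbabilityMeasure ν]
    (hν : ∫⁻ x, ‖x‖ₑ ^ 2 ∂ν < ∞) (v : Vec n) :
    ∫⁻ x, ‖x - v‖ₑ ^ 2 ∂ν =
      ∫⁻ x, ‖x - ∫ z, z ∂ν‖ₑ ^ 2 ∂ν + ‖(∫ z, z ∂ν) - v‖ₑ ^ 2 := by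
  have hmem : MemLp (fun x : Vec n => x) 2 ν := by
    refine ⟨by fun_prop, ?_⟩
    rw [eLpNorm_lt_top_iff_lintegral_rpow_enorm_lt_top two_ne_zero ENNReal.ofNat_ne_top]
    simpa using hν
  have hint : Integrable (fun x : Vec n => x) ν := hmem.integrable one_le_two
  set μ := ∫ z, z ∂ν with hμ
  have e : ∀ w : Vec n, ∫⁻ x, ‖x - w‖ₑ ^ 2 ∂ν = ENNReal.ofReal (∫ x, ‖x - w‖ ^ 2 ∂ν) := fun w => by
    rw [ofReal_integral_eq_lintegral_ofReal]
    · exact lintegral_congr fun x => by rw [ENNReal.ofReal_pow (norm_nonneg _), ofReal_norm]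
    · exact ((hmem.sub (memLp_const w)).integrable_norm_pow two_ne_zero)
    · exact ae_of_all _ fun x => sq_nonneg _
  have i1 : Integrable (fun x => ‖x - μ‖ ^ 2) ν :=
    (hmem.sub (memLp_const μ)).integrable_norm_pow two_ne_zero
  have i2 : Integrable (fun x => x - μ) ν := hint.sub (integrable_const μ)
  have key : ∫ x, ‖x - v‖ ^ 2 ∂ν = ∫ x, ‖x - μ‖ ^ 2 ∂ν + ‖μ - v‖ ^ 2 := by
    have h1 : ∀ x, ‖x - v‖ ^ 2 =
        ‖x - μ‖ ^ 2 + (2 * inner ℝ (μ - v) (x - μ) + ‖μ - v‖ ^ 2) := fun x => by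
      rw [show x - v = (x - μ) + (μ - v) by abel, norm_add_sq_real, real_inner_comm]
      ring
    have h2 : ∫ x, inner ℝ (μ - v) (x - μ) ∂ν = 0 := by
      rw [integral_inner i2, integral_sub hint (integrable_const μ)]
      simp [← hμ]
    have i3 : Integrable (fun x => 2 * inner ℝ (μ - v) (x - μ)) ν :=
      (i2.const_inner _).const_mul 2
    have i4 : Integrable (fun x => 2 * inner ℝ (μ - v) (x - μ) + ‖μ - v‖ ^ 2) ν :=
      i3.add (integrable_const _)
    rw [integral_congr_ae (ae_of_all _ h1), integral_add i1 i4, integral_add i3 (integrable_const _),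
      integral_const_mul, h2]
    simp
  rw [e, e, key, ENNReal.ofReal_add (integral_nonneg fun x => sq_nonneg _) (sq_nonneg _),
    ENNReal.ofReal_pow (norm_nonneg _), ofReal_norm]

lemma enorm_mean_sub_particleMean_sq {n N : ℕ} {ν : Measure (Vec n)}
    (hint : Integrable (fun x : Vec n => x) ν) (x : Fin N → Vec n) :
    ‖(∫ z, z ∂ν) - particleMean x‖ₑ ^ 2 =
      ∑ j, ENNReal.ofReal ((empMean (fun z : Vec n => z j) x - ∫ z, z j ∂ν) ^ 2) := by
  have h1 : ∀ j, (∫ z, z ∂ν) j = ∫ z, z j ∂ν := fun j =>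
    ((EuclideanSpace.proj j : Vec n →L[ℝ] ℝ).integral_comp_comm hint).symm
  have h2 : ∀ j, particleMean x j = empMean (fun z : Vec n => z j) x := fun j => by
    simp [particleMean, empMean]
  rw [← ofReal_norm, ← ENNReal.ofReal_pow (norm_nonneg _), EuclideanSpace.norm_sq_eq,
    ENNReal.ofReal_sum_of_nonneg fun j _ => sq_nonneg _]
  refine Finset.sum_congr rfl fun j _ => ?_
  rw [PiLp.sub_apply, h1, h2, Real.norm_eq_abs, sq_abs, ← neg_sq, neg_sub]

lemma measurable_particleMean {n N : ℕ} :
    Measurable (particleMean : (Fin N → Vec n) → Vec n) := by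
  unfold particleMean; fun_prop

section Estimates

variable {Ω : Type*} [MeasurableSpace Ω] {nx nu ny : ℕ} {P : Measure Ω} [IsProbabilityMeasure P]
  {X : ℕ → Ω → Vec nx} {Y : ℕ → Ω → Vec ny} {U : ℕ → Ω → Vec nu} {k : ℕ}

lemma lintegral_filterLaw_enorm_sq (hI : Measurable (infoVec Y U k)) (hX : Measurable (X k)) :
    ∫⁻ ω, ∫⁻ x, ‖x‖ₑ ^ 2 ∂(filterLaw P X Y U k (infoVec Y U k ω)) ∂P = ∫⁻ ω, ‖X k ω‖ₑ ^ 2 ∂P :=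
  (lintegral_condDistrib hI hX (g := fun p => ‖p.2‖ₑ ^ 2) (by fun_prop)).symm

lemma ae_lintegral_filterLaw_enorm_sq_lt_top (hI : Measurable (infoVec Y U k))
    (hX : Measurable (X k)) (h2 : ∫⁻ ω, ‖X k ω‖ₑ ^ 2 ∂P < ∞) :
    ∀ᵐ ω ∂P, ∫⁻ x, ‖x‖ₑ ^ 2 ∂(filterLaw P X Y U k (infoVec Y U k ω)) < ∞ := by
  refine ae_lt_top ?_ ?_
  · exact ((by fun_prop : Measurable fun x : Vec nx => ‖x‖ₑ ^ 2).lintegral_kernel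
      (κ := filterLaw P X Y U k)).comp hI
  · rw [lintegral_filterLaw_enorm_sq hI hX]
    exact h2.ne

/-- The optimal error is the mean variance of the filtering law. -/
lemma optTotalMSE_eq (hI : Measurable (infoVec Y U k)) (hX : Measurable (X k))
    (h2 : ∫⁻ ω, ‖X k ω‖ₑ ^ 2 ∂P < ∞) :
    optTotalMSE P X Y U k = ∫⁻ ω, ∫⁻ x, ‖x - ∫ z, z ∂(filterLaw P X Y U k (infoVec Y U k ω))‖ₑ ^ 2
      ∂(filterLaw P X Y U k (infoVec Y U k ω)) ∂P := by
  have hint : Integrable (X k) P := by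
    have : MemLp (X k) 2 P := by
      refine ⟨by fun_prop, ?_⟩
      rw [eLpNorm_lt_top_iff_lintegral_rpow_enorm_lt_top two_ne_zero ENNReal.ofNat_ne_top]
      simpa using h2
    exact this.integrable one_le_two
  have hopt : optEstimator P X Y U k =ᵐ[P]
      fun ω => ∫ z, z ∂(filterLaw P X Y U k (infoVec Y U k ω)) :=
    condExp_ae_eq_integral_condDistrib' hI hint
  have mmean : Measurable fun i => ∫ z, z ∂(filterLaw P X Y U k i) :=
    (stronglyMeasurable_id.integral_kernel (κ := filterLaw P X Y U k)).measurable
  calc optTotalMSE P X Y U k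
      = ∫⁻ ω, ‖X k ω - ∫ z, z ∂(filterLaw P X Y U k (infoVec Y U k ω))‖ₑ ^ 2 ∂P := by
        refine lintegral_congr_ae ?_
        filter_upwards [hopt] with ω hω
        rw [hω]
    _ = _ := lintegral_condDistrib hI hX
        (g := fun p => ‖p.2 - ∫ z, z ∂(filterLaw P X Y U k p.1)‖ₑ ^ 2)
        ((measurable_snd.sub (mmean.comp measurable_fst)).enorm.pow_const 2)

lemma optTotalMSE_lt_top (hI : Measurable (infoVec Y U k)) (hX : Measurable (X k))
    (h2 : ∫⁻ ω, ‖X k ω‖ₑ ^ 2 ∂P < ∞) : optTotalMSE P X Y U k < ∞ := by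
  refine lt_of_le_of_lt ?_ h2
  rw [optTotalMSE_eq hI hX h2, ← lintegral_filterLaw_enorm_sq (Y := Y) (U := U) hI hX]
  refine lintegral_mono_ae ?_
  filter_upwards [ae_lintegral_filterLaw_enorm_sq_lt_top hI hX h2] with ω hω
  have h := lintegral_enorm_sub_sq hω 0
  simp only [sub_zero] at h
  rw [h]
  exact le_self_add

/-- Since the particles are conditionally independent of `X_k` given `I_k`, the error of the particle
estimate is the optimal error plus the mean squared distance to the filtered mean. -/
lemma particleTotalMSE_eq {N : ℕ} (hI : Measurable (infoVec Y U k)) (hX : Measurable (X k))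
    (h2 : ∫⁻ ω, ‖X k ω‖ₑ ^ 2 ∂P < ∞) (κ : Kernel (Info ny nu k) (Fin N → Vec nx))
    [IsMarkovKernel κ] :
    particleTotalMSE P X Y U k κ = optTotalMSE P X Y U k +
      ∫⁻ ω, ∫⁻ x, ‖(∫ z, z ∂(filterLaw P X Y U k (infoVec Y U k ω))) - particleMean x‖ₑ ^ 2
        ∂(κ (infoVec Y U k ω)) ∂P := by
  have mp := measurable_particleMean (n := nx) (N := N)
  have mmean : Measurable fun i => ∫ z, z ∂(filterLaw P X Y U k i) :=
    (stronglyMeasurable_id.integral_kernel (κ := filterLaw P X Y U k)).measurable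
  have m1 : Measurable fun p : Info ny nu k × Vec nx =>
      ∫⁻ x, ‖p.2 - particleMean x‖ₑ ^ 2 ∂(κ p.1) := by
    have : Measurable (Function.uncurry fun (p : Info ny nu k × Vec nx) (x : Fin N → Vec nx) =>
        ‖p.2 - particleMean x‖ₑ ^ 2) := by
      unfold Function.uncurry; fun_prop
    exact this.lintegral_kernel_prod_right (κ := κ.comap Prod.fst measurable_fst)
  have m2 : Measurable fun i => ∫⁻ x, ‖x - ∫ z, z ∂(filterLaw P X Y U k i)‖ₑ ^ 2
      ∂(filterLaw P X Y U k i) := by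
    have : Measurable (Function.uncurry fun (i : Info ny nu k) (x : Vec nx) =>
        ‖x - ∫ z, z ∂(filterLaw P X Y U k i)‖ₑ ^ 2) :=
      (measurable_snd.sub (mmean.comp measurable_fst)).enorm.pow_const 2
    exact this.lintegral_kernel_prod_right (κ := filterLaw P X Y U k)
  calc particleTotalMSE P X Y U k κ
      = ∫⁻ ω, ∫⁻ z, ∫⁻ x, ‖z - particleMean x‖ₑ ^ 2 ∂(κ (infoVec Y U k ω))
          ∂(filterLaw P X Y U k (infoVec Y U k ω)) ∂P := lintegral_condDistrib hI hX m1
    _ = ∫⁻ ω, (∫⁻ x, ‖x - ∫ z, z ∂(filterLaw P X Y U k (infoVec Y U k ω))‖ₑ ^ 2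
          ∂(filterLaw P X Y U k (infoVec Y U k ω)) +
        ∫⁻ x, ‖(∫ z, z ∂(filterLaw P X Y U k (infoVec Y U k ω))) - particleMean x‖ₑ ^ 2
          ∂(κ (infoVec Y U k ω))) ∂P := by
        refine lintegral_congr_ae ?_
        filter_upwards [ae_lintegral_filterLaw_enorm_sq_lt_top hI hX h2] with ω hω
        rw [lintegral_lintegral_swap (by fun_prop),
          lintegral_congr fun x => lintegral_enorm_sub_sq hω (particleMean x),
          lintegral_add_left measurable_const, lintegral_const, measure_univ, mul_one]
    _ = _ := (lintegral_add_left (m2.comp hI) _).trans (by rw [optTotalMSE_eq hI hX h2]; rfl)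

lemma measurable_coordNorm (hI : ∀ l, Measurable (infoVec Y U l)) (j : Fin nx) :
    Measurable (coordNorm P X Y U k j) := by
  refine measurable_const.max (Measurable.iSup fun l => Measurable.pow_const ?_ _)
  exact ((by fun_prop : Measurable fun x : Vec nx => ‖x j‖ₑ ^ 2).lintegral_kernel
    (κ := filterLaw P X Y U l)).comp (hI l)

lemma rpow_half_sq (t : ℝ≥0∞) : (t ^ (1 / 2 : ℝ)) ^ 2 = t := by
  rw [← ENNReal.rpow_natCast, ← ENNReal.rpow_mul]
  simp

/-- Only the moment at time `0` enters the error bound; at later times `ρ φ_j²` bounds the second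
moments, and `coordNorm` is used only through `one_le_coordNorm_sq`. -/
lemma lintegral_coord_sq_le_coordNorm_sq (j : Fin nx) (ω : Ω) :
    ∫⁻ x, ‖x j‖ₑ ^ 2 ∂(filterLaw P X Y U 0 (infoVec Y U 0 ω)) ≤ coordNorm P X Y U k j ω ^ 2 := by
  rw [← rpow_half_sq (∫⁻ x, ‖x j‖ₑ ^ 2 ∂(filterLaw P X Y U 0 (infoVec Y U 0 ω)))]
  gcongr
  refine le_max_of_le_right ?_
  exact le_iSup (fun l : Fin (k + 1) =>
    (∫⁻ x, ‖x j‖ₑ ^ 2 ∂(filterLaw P X Y U l (infoVec Y U l ω))) ^ (1 / 2 : ℝ)) 0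

lemma one_le_coordNorm_sq (j : Fin nx) (ω : Ω) : 1 ≤ coordNorm P X Y U k j ω ^ 2 :=
  one_le_pow₀ (le_max_left _ _)

lemma lintegral_coordNorm_sq_lt_top (hI : ∀ l, Measurable (infoVec Y U l))
    (hX : ∀ l, Measurable (X l)) (h2 : ∀ l, ∫⁻ ω, ‖X l ω‖ₑ ^ 2 ∂P < ∞) (j : Fin nx) :
    ∫⁻ ω, coordNorm P X Y U k j ω ^ 2 ∂P < ∞ := by
  have hle : ∀ ω, coordNorm P X Y U k j ω ^ 2 ≤
      1 + ∑ l : Fin (k + 1), ∫⁻ x, ‖x‖ₑ ^ 2 ∂(filterLaw P X Y U l (infoVec Y U l ω)) := by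
    intro ω
    set T := 1 + ∑ l : Fin (k + 1), ∫⁻ x, ‖x‖ₑ ^ 2 ∂(filterLaw P X Y U l (infoVec Y U l ω))
    have h1 : (1 : ℝ≥0∞) ≤ T := le_self_add
    rw [← rpow_half_sq T]
    refine pow_le_pow_left₀ zero_le (max_le (ENNReal.one_le_rpow h1 (by norm_num))
      (iSup_le fun l => ENNReal.rpow_le_rpow ?_ (by norm_num))) 2
    calc ∫⁻ x, ‖x j‖ₑ ^ 2 ∂(filterLaw P X Y U l (infoVec Y U l ω))
        ≤ ∫⁻ x, ‖x‖ₑ ^ 2 ∂(filterLaw P X Y U l (infoVec Y U l ω)) := by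
          refine lintegral_mono fun x => ?_
          gcongr
          exact enorm_le_iff_norm_le.2 (PiLp.norm_apply_le x j)
      _ ≤ ∑ l : Fin (k + 1), ∫⁻ x, ‖x‖ₑ ^ 2 ∂(filterLaw P X Y U l (infoVec Y U l ω)) :=
          Finset.single_le_sum (f := fun l : Fin (k + 1) =>
            ∫⁻ x, ‖x‖ₑ ^ 2 ∂(filterLaw P X Y U l (infoVec Y U l ω))) (fun _ _ => zero_le)
            (Finset.mem_univ l)
      _ ≤ T := le_add_self
  refine (lintegral_mono hle).trans_lt ?_
  rw [lintegral_add_left measurable_const, lintegral_finsetSum]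
  · simp only [lintegral_const, measure_univ, mul_one, lintegral_filterLaw_enorm_sq (hI _) (hX _)]
    exact ENNReal.add_lt_top.2 ⟨ENNReal.one_lt_top, ENNReal.sum_lt_top.2 fun l _ => h2 l⟩
  · intro l _
    exact ((by fun_prop : Measurable fun x : Vec nx => ‖x‖ₑ ^ 2).lintegral_kernel
      (κ := filterLaw P X Y U l)).comp (hI l)

end Estimates

/-! ### The error bound -/

/-- The constants of the error bound for the coordinates `φ_j`: one step from the constant for
bounded test functions, with `ρ φ_j²` bounded by `Bφ j` and `φ_j(0) = 0`. The summand `1` keeps them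
positive if the bounds vanish. -/
noncomputable def coordConst {nx : ℕ} (γ : ℕ → ℝ≥0) (Bρ : ℝ≥0) (Bφ : Fin nx → ℝ≥0) :
    ℕ → Fin nx → ℝ≥0
  | 0, _ => 1
  | k + 1, j => stepConst (γ (k + 1)) Bρ (errConst γ Bρ k) (Bφ j) 0 + 1

section Bound

variable {Ω : Type*} [MeasurableSpace Ω] {nx nu nξ ny nη : ℕ}
  {M : ControlledSystem nx nu nξ ny nη} {P : Measure Ω} [IsProbabilityMeasure P]
  {π : (k : ℕ) → Info ny nu k → Vec nu}
  {X : ℕ → Ω → Vec nx} {Y : ℕ → Ω → Vec ny} {U : ℕ → Ω → Vec nu}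
  {ξ : ℕ → Ω → Vec nξ} {η : ℕ → Ω → Vec nη} {γ : ℕ → ℝ≥0} {ε : ℕ → ℝ}
  {BK Bρ : ℝ≥0} {Bφ : Fin nx → ℝ≥0}

lemma UniformlyBounded.ρ_le (h : UniformlyBounded M BK Bρ Bφ) (y : Vec ny) (x : Vec nx) :
    M.ρ y x ≤ Bρ :=
  ENNReal.coe_le_coe.1 ((le_iSup₂ (f := fun x y => (M.ρ y x : ℝ≥0∞)) x y).trans h.bound_ρ)

lemma UniformlyBounded.coord_le (h : UniformlyBounded M BK Bρ Bφ) (j : Fin nx) (y : Vec ny)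
    (x : Vec nx) : (M.ρ y x : ℝ) * x j ^ 2 ≤ Bφ j := by
  have h1 := (le_iSup₂ (f := fun (x : Vec nx) y => ‖x j‖ₑ ^ 2 * (M.ρ y x : ℝ≥0∞)) x y).trans
    (h.bound_φ j)
  rw [enorm_eq_nnnorm] at h1
  have h2 : ‖x j‖₊ ^ 2 * M.ρ y x ≤ Bφ j := by exact_mod_cast h1
  have h3 : ‖x j‖ ^ 2 * M.ρ y x ≤ (Bφ j : ℝ) := by exact_mod_cast h2
  rwa [Real.norm_eq_abs, sq_abs, mul_comm] at h3

/-- Almost surely, the filtering laws along the realised information vectors satisfy the filtering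
recursion. -/
lemma IsClosedLoop.ae_isFilterRecursion (h : IsClosedLoop M P π X Y U ξ η)
    (hρ : ∀ y x, M.ρ y x ≤ Bρ)
    (hγ : ∀ k, ∀ᵐ ω ∂P, (γ (k + 1) : ℝ≥0∞) ≤
      ∫⁻ x, (M.ρ (Y (k + 1) ω) x : ℝ≥0∞) ∂(predictedLaw P X Y U k (infoVec Y U k ω))) :
    ∀ᵐ ω ∂P, IsFilterRecursion M γ (fun k => infoVec Y U k ω)
      fun k => filterLaw P X Y U k (infoVec Y U k ω) := by
  filter_upwards [ae_all_iff.2 h.predictedLaw_eq, ae_all_iff.2 (h.filterLaw_succ_eq hρ),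
    ae_all_iff.2 hγ] with ω h1 h2 h3
  refine ⟨fun k => inferInstance, fun k => rfl, fun k => ?_, fun k => ?_⟩
  · have := h3 k
    rwa [h1 k] at this
  · have := h2 k
    rwa [h1 k] at this

/-- The particle mean is close to the filtered mean: the errors of the coordinates, bounded for
almost every trajectory, add up. -/
lemma lintegral_mean_sub_particleMean_le (h : IsClosedLoop M P π X Y U ξ η)
    (hB : UniformlyBounded M BK Bρ Bφ) (hγ : ∀ k, 0 < γ (k + 1))
    (hZ : ∀ k, ∀ᵐ ω ∂P, (γ (k + 1) : ℝ≥0∞) ≤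
      ∫⁻ x, (M.ρ (Y (k + 1) ω) x : ℝ≥0∞) ∂(predictedLaw P X Y U k (infoVec Y U k ω)))
    (h2 : ∀ k, ∫⁻ ω, ‖X k ω‖ₑ ^ 2 ∂P < ∞) {N : ℕ} (hN : 0 < N)
    (a : ℕ → doublyStochastic ℝ≥0 (Fin N)) (k : ℕ) :
    ∫⁻ ω, ∫⁻ x, ‖(∫ z, z ∂(filterLaw P X Y U k (infoVec Y U k ω))) - particleMean x‖ₑ ^ 2
        ∂(particleFilter M P X Y U γ a k (infoVec Y U k ω)) ∂P ≤
      (∑ j, (coordConst γ Bρ Bφ k j : ℝ≥0∞) * ∫⁻ ω, coordNorm P X Y U k j ω ^ 2 ∂P) / N := by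
  have mI := h.measurable_infoVec
  have mX := h.measurable_X
  have mC := fun j => measurable_coordNorm (P := P) (X := X) (k := k) mI j
  have hpt : ∀ᵐ ω ∂P,
      ∫⁻ x, ‖(∫ z, z ∂(filterLaw P X Y U k (infoVec Y U k ω))) - particleMean x‖ₑ ^ 2
        ∂(particleFilter M P X Y U γ a k (infoVec Y U k ω)) ≤
      (∑ j, (coordConst γ Bρ Bφ k j : ℝ≥0∞) * coordNorm P X Y U k j ω ^ 2) / N := by
    filter_upwards [h.ae_isFilterRecursion hB.ρ_le hZ,
      ae_lintegral_filterLaw_enorm_sq_lt_top (mI k) (mX k) (h2 k)] with ω hrec hfin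
    have hmem : MemLp (fun x : Vec nx => x) 2 (filterLaw P X Y U k (infoVec Y U k ω)) := by
      refine ⟨by fun_prop, ?_⟩
      rw [eLpNorm_lt_top_iff_lintegral_rpow_enorm_lt_top two_ne_zero ENNReal.ofNat_ne_top]
      simpa using hfin
    have mc : ∀ j, Measurable fun z : Vec nx => z j := fun j => by fun_prop
    simp_rw [enorm_mean_sub_particleMean_sq (hmem.integrable one_le_two)]
    rw [lintegral_finsetSum _ fun j _ => by fun_prop, div_eq_mul_inv, Finset.sum_mul]
    refine Finset.sum_le_sum fun j _ => ?_
    change sqErr _ (fun z : Vec nx => z j) _ ≤ _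
    rw [← div_eq_mul_inv]
    cases k with
    | zero =>
      have hmj : MemLp (fun x : Vec nx => x j) 2 (filterLaw P X Y U 0 (infoVec Y U 0 ω)) :=
        hmem.mono (by fun_prop) (ae_of_all _ fun x => PiLp.norm_apply_le x j)
      refine (hrec.sqErr_zero_le hN rfl a _ hmj).trans ?_
      gcongr
      rw [ofReal_integral_eq_lintegral_ofReal hmj.integrable_sq (ae_of_all _ fun x => sq_nonneg _),
        coordConst, ENNReal.coe_one, one_mul]
      refine le_trans (le_of_eq (lintegral_congr fun x => ?_))
        (lintegral_coord_sq_le_coordNorm_sq (k := 0) j ω)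
      rw [← ofReal_norm, ← ENNReal.ofReal_pow (norm_nonneg _), Real.norm_eq_abs, sq_abs]
    | succ k =>
      have hk := hrec.hasMeanSquareError hN hB.ρ_le hγ rfl a k
      refine (hrec.sqErr_succ_le hN hB.ρ_le a k (hγ k) hk (mc j) (hB.coord_le j) (d := 0)
        (by simp)).trans ?_
      gcongr
      calc (stepConst (γ (k + 1)) Bρ (errConst γ Bρ k) (Bφ j) 0 : ℝ≥0∞)
          ≤ (coordConst γ Bρ Bφ (k + 1) j : ℝ≥0∞) * 1 := by
            rw [mul_one, coordConst, ENNReal.coe_add]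
            exact le_self_add
        _ ≤ _ := by
            gcongr
            exact one_le_coordNorm_sq j ω
  refine (lintegral_mono_ae hpt).trans (le_of_eq ?_)
  simp only [div_eq_mul_inv]
  rw [lintegral_mul_const _ (by fun_prop), lintegral_finsetSum _ fun j _ => by fun_prop]
  congr 1
  exact Finset.sum_congr rfl fun j _ => lintegral_const_mul _ (by fun_prop)

end Bound

theorem mainTheorem3 {nx nu nξ ny nη : ℕ}
    (γ : ℕ → ℝ≥0) (hγ : ∀ k, 1 ≤ k → 0 < γ k)
    (ε : ℕ → ℝ) (hε : ∀ k, 1 ≤ k → 0 < ε k ∧ ε k < 1)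
    (BK Bρ : ℝ≥0) (Bφ : Fin nx → ℝ≥0) :
    -- `C` and `Nbar` depend only on the dimensions, on `γ`, `ε` and the bounds (and `Nbar` on `q`)
    ∃ C : ℕ → Fin nx → ℝ≥0, (∀ k j, 0 < C k j) ∧
      ∀ q : ℝ, 0 < q → q < 1 → ∃ Nbar : ℕ → ℕ, (∀ k, 0 < Nbar k) ∧
        ∀ {Ω : Type*} [MeasurableSpace Ω] (P : Measure Ω) [IsProbabilityMeasure P]
          (M : ControlledSystem nx nu nξ ny nη) (π : (k : ℕ) → Info ny nu k → Vec nu)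
          (X : ℕ → Ω → Vec nx) (Y : ℕ → Ω → Vec ny) (U : ℕ → Ω → Vec nu)
          (ξ : ℕ → Ω → Vec nξ) (η : ℕ → Ω → Vec nη)
          (a : (N : ℕ) → ℕ → doublyStochastic ℝ≥0 (Fin N)),
          IsClosedLoop M P π X Y U ξ η →
          LikelihoodBoundedBelow M P X Y U γ ε a →
          UniformlyBounded M BK Bρ Bφ →
          (∀ k, ∫⁻ ω, ‖X k ω‖ₑ ^ 2 ∂P < ∞) →
          ∀ k : ℕ,
            (∀ N : ℕ, Nbar k ≤ N →
              optTotalMSE P X Y U k ≤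
                particleTotalMSE P X Y U k (particleFilter M P X Y U γ (a N) k) ∧
              particleTotalMSE P X Y U k (particleFilter M P X Y U γ (a N) k) ≤
                totalMSEBound P X Y U C q k N ∧
              totalMSEBound P X Y U C q k N < ∞) ∧
            Tendsto
              (fun N : ℕ =>
                particleTotalMSE P X Y U k (particleFilter M P X Y U γ (a N) k))
              atTop (𝓝 (optTotalMSE P X Y U k)) := by
  -- The error bound holds for every `N ≥ 1`: the probability of rejecting a proposal is itself
  -- `O(1/N)` and is part of the constants.
  refine ⟨coordConst γ Bρ Bφ, fun k j => ?_, fun q hq0 _ => ⟨fun _ => 1, fun _ => one_pos, ?_⟩⟩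
  · cases k with
    | zero => exact one_pos
    | succ k => exact add_pos_of_nonneg_of_pos zero_le one_pos
  intro Ω _ P _ M π X Y U ξ η a h hL hB h2 k
  have mI := h.measurable_infoVec
  have mX := h.measurable_X
  set S : ℝ≥0∞ := ∑ j, (coordConst γ Bρ Bφ k j : ℝ≥0∞) * ∫⁻ ω, coordNorm P X Y U k j ω ^ 2 ∂P
    with hS
  have hStop : S < ∞ := ENNReal.sum_lt_top.2 fun j _ =>
    ENNReal.mul_lt_top ENNReal.coe_lt_top (lintegral_coordNorm_sq_lt_top mI mX h2 j)
  have hopt : optTotalMSE P X Y U k < ∞ := optTotalMSE_lt_top (mI k) (mX k) (h2 k)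
  have hmain : ∀ N : ℕ, 1 ≤ N →
      optTotalMSE P X Y U k ≤ particleTotalMSE P X Y U k (particleFilter M P X Y U γ (a N) k) ∧
      particleTotalMSE P X Y U k (particleFilter M P X Y U γ (a N) k) ≤
        optTotalMSE P X Y U k + S / N := fun N hN => by
    have hmarkov : IsMarkovKernel (particleFilter M P X Y U γ (a N) k) := by
      unfold particleFilter; infer_instance
    rw [particleTotalMSE_eq (mI k) (mX k) (h2 k)]
    refine ⟨le_self_add, add_le_add le_rfl ?_⟩
    exact lintegral_mean_sub_particleMean_le h hB (fun l => hγ (l + 1) (by omega)) hL.predicted h2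
      hN (a N) k
  refine ⟨fun N hN => ⟨(hmain N hN).1, (hmain N hN).2.trans ?_, ?_⟩, ?_⟩
  · calc optTotalMSE P X Y U k + S / N = 1 * optTotalMSE P X Y U k + 1 * (S / N) := by
          rw [one_mul, one_mul]
      _ ≤ totalMSEBound P X Y U (coordConst γ Bρ Bφ) q k N := by
          unfold totalMSEBound
          gcongr
          exacts [le_self_add, le_self_add]
  · have hN0 : (N : ℝ≥0∞) ≠ 0 := by exact_mod_cast (Nat.one_le_iff_ne_zero.1 hN)
    have hNt : (N : ℝ≥0∞) ≠ ∞ := ENNReal.natCast_ne_top N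
    have hNq : (N : ℝ≥0∞) ^ q ≠ ∞ := ENNReal.rpow_ne_top_of_nonneg hq0.le hNt
    have hNq0 : (N : ℝ≥0∞) ^ q ≠ 0 := (ENNReal.rpow_pos (pos_iff_ne_zero.2 hN0) hNt).ne'
    refine ENNReal.add_lt_top.2 ⟨ENNReal.mul_lt_top ?_ hopt, ENNReal.mul_lt_top ?_ ?_⟩
    · exact ENNReal.add_lt_top.2 ⟨ENNReal.one_lt_top, ENNReal.div_lt_top ENNReal.one_ne_top hNq0⟩
    · exact ENNReal.add_lt_top.2 ⟨ENNReal.one_lt_top, hNq.lt_top⟩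
    · exact ENNReal.div_lt_top hStop.ne hN0
  · have hlim : Tendsto (fun N : ℕ => optTotalMSE P X Y U k + S / N) atTop
        (𝓝 (optTotalMSE P X Y U k)) := by
      have h0 : Tendsto (fun N : ℕ => S / N) atTop (𝓝 0) := by
        have := ENNReal.Tendsto.const_div (a := S) ENNReal.tendsto_nat_nhds_top (Or.inr hStop.ne)
        simpa using this
      simpa using tendsto_const_nhds.add h0
    refine tendsto_of_tendsto_of_tendsto_of_le_of_le' tendsto_const_nhds hlim ?_ ?_
    · filter_upwards [eventually_ge_atTop 1] with N hN using (hmain N hN).1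
    · filter_upwards [eventually_ge_atTop 1] with N hN using (hmain N hN).2
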